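/- Let $\kappa>0$ and let $\vec f,\vec g:\mathbb R^3\to\mathbb R^3$ be vector fields in $\dot H^{-1}(\mathbb R^3)\cap\dot H^{-2}(\mathbb R^3)$ with $\mathrm{div}(\vec f)=0$. Assume that $\vec f=\vec g=0$, or that $\vec f$ and $\vec g$ are of class $C^\infty$. Let $(\vec u,p,\vec\omega)$, with $\vec u,\vec\omega:\mathbb R^3\to\mathbb R^3$ and $p:\mathbb R^3\to\mathbb R$, be a weak solution (in the sense of distributions) of the stationary micropolar fluid equations $$\begin{cases}\Delta\vec u-(\vec u\cdot\vec\nabla)\vec u-\vec\nabla p+\tfrac12\vec\nabla\wedge\vec\omega+\vec f=0,\qquad \mathrm{div}(\vec u)=0,\\ \Delta\vec\omega+\vec\nabla\,\mathrm{div}(\vec\omega)-\kappa\vec\omega-(\vec u\cdot\vec\nabla)\vec\omega+\tfrac12\vec\nabla\wedge\vec u+\vec g=0\end{cases}$$ on $\mathbb R^3$ such that $\vec u\in\dot H^1(\mathbb R^3)$, $\vec\omega\in H^1(\mathbb R^3)$ and $p\in\dot H^{1/2}(\mathbb R^3)$. Then $\vec u$, $p$ and $\vec\omega$ are of class $C^\infty$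 (after modification on a set of measure zero). Here $\dot H^s(\mathbb R^3)$ is the space of tempered distributions $T$ whose Fourier transform is a locally integrable function with $\int_{\mathbb R^3}|\xi|^{2s}|\widehat T(\xi)|^2\,d\xi<\infty$. -/

import Mathlib

open MeasureTheory
open scoped ContDiff SchwartzMap FourierTransform Laplacian Gradient

/-- Three-dimensional Euclidean space. -/
abbrev E3 : Type := EuclideanSpace ℝ (Fin 3)

/-- The function `f` is locally integrable and the distribution that it defines (by integration
against compactly supported smooth functions) is the tempered distribution `T`. Compactly supported
smooth functions are dense in the Schwartz space, so there is at most one such `T`. -/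
def Represents (f : E3 → ℝ) (T : 𝓢'(E3, ℂ)) : Prop :=
  LocallyIntegrable f ∧
    ∀ φ : 𝓢(E3, ℂ), HasCompactSupport (φ : E3 → ℂ) → T φ = ∫ x, (f x : ℂ) * φ x

/-- The homogeneous Sobolev space of order `s`, based on `L²`: tempered distributions whose Fourier
transform is a locally integrable function `h` with `∫ ‖ξ‖ ^ (2 * s) * ‖h ξ‖ ^ 2 < ∞`. -/
def MemHomSobolev (s : ℝ) (T : 𝓢'(E3, ℂ)) : Prop :=
  ∃ h : E3 → ℂ, LocallyIntegrable h ∧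
    (∀ φ : 𝓢(E3, ℂ), (𝓕 T) φ = ∫ ξ, h ξ * φ ξ) ∧
    MemLp (fun ξ => ((‖ξ‖ ^ s : ℝ) : ℂ) * h ξ) 2

/-- The real function `f` belongs to the homogeneous Sobolev space of order `s`. -/
def InHomSobolev (s : ℝ) (f : E3 → ℝ) : Prop :=
  ∃ T : 𝓢'(E3, ℂ), Represents f T ∧ MemHomSobolev s T

/-- The vector field `v` belongs to the homogeneous Sobolev space of order `s`. -/
def VecInHomSobolev (s : ℝ) (v : E3 → E3) : Prop :=
  ∀ i, InHomSobolev s (fun x => v x i)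

/-- The vector field `v` belongs to the inhomogeneous Sobolev space of order `s`, based
on `L²`. -/
def VecInSobolev (s : ℝ) (v : E3 → E3) : Prop :=
  ∀ i, ∃ T : 𝓢'(E3, ℂ), Represents (fun x => v x i) T ∧ TemperedDistribution.MemSobolev s 2 T

/-- The partial derivative in the `j`-th coordinate direction of a scalar function. -/
noncomputable def pderiv3 (j : Fin 3) (a : E3 → ℝ) (x : E3) : ℝ :=
  fderiv ℝ a x (EuclideanSpace.single j 1)

/-- The divergence of a differentiable vector field. -/
noncomputable def divergence3 (Φ : E3 → E3) (x : E3) : ℝ :=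
  ∑ j, pderiv3 j (fun y => Φ y j) x

/-- The curl of a differentiable vector field. -/
noncomputable def curl3 (Φ : E3 → E3) (x : E3) : E3 :=
  !₂[pderiv3 1 (fun y => Φ y 2) x - pderiv3 2 (fun y => Φ y 1) x,
     pderiv3 2 (fun y => Φ y 0) x - pderiv3 0 (fun y => Φ y 2) x,
     pderiv3 0 (fun y => Φ y 1) x - pderiv3 1 (fun y => Φ y 0) x]

/-- The locally integrable vector field `v` is divergence free in the sense of distributions. -/
def WeaklyDivFree (v : E3 → E3) : Prop :=
  ∀ φ : E3 → ℝ, ContDiff ℝ ∞ φ → HasCompactSupport φ → ∫ x, inner ℝ (v x) (∇ φ x) = 0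

/-- `(u, p, w)` (velocity, pressure, microrotation) is a weak solution (in the sense of distributions) of the stationary micropolar
fluid equations on the whole space
`Δ u - (u · ∇) u - ∇ p + (1/2) curl w + f = 0`, `div u = div f = 0`,
`Δ w + ∇ (div w) - κ w - (u · ∇) w + (1/2) curl u + g = 0`.
As `div u = 0`, the convective terms are `div (u ⊗ u)` and `div (u ⊗ w)`; all derivatives are moved
onto the test field `Φ`, and the `j`-th coordinates of `u` contract with the derivatives `∂ⱼ Φ`
into `fderiv ℝ Φ x (u x)`. -/
structure IsWeakMicropolarSolution (κ : ℝ) (f g u : E3 → E3) (p : E3 → ℝ) (w : E3 → E3) :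
    Prop where
  /-- the unknowns and the forces are regular enough for the integrals below to make sense -/
  memLp_u : ∀ K : Set E3, IsCompact K → MemLp u 2 (volume.restrict K)
  memLp_w : ∀ K : Set E3, IsCompact K → MemLp w 2 (volume.restrict K)
  locallyIntegrable_p : LocallyIntegrable p
  locallyIntegrable_f : LocallyIntegrable f
  locallyIntegrable_g : LocallyIntegrable g
  div_u : WeaklyDivFree u
  div_f : WeaklyDivFree f
  velocity_eq : ∀ Φ : E3 → E3, ContDiff ℝ ∞ Φ → HasCompactSupport Φ →
    ∫ x, (inner ℝ (u x) (Δ Φ x) + inner ℝ (u x) (fderiv ℝ Φ x (u x)) + p x * divergence3 Φ x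
      + (1 / 2) * inner ℝ (w x) (curl3 Φ x) + inner ℝ (f x) (Φ x)) = 0
  microrotation_eq : ∀ Φ : E3 → E3, ContDiff ℝ ∞ Φ → HasCompactSupport Φ →
    ∫ x, (inner ℝ (w x) (Δ Φ x) + inner ℝ (w x) (∇ (divergence3 Φ) x) - κ * inner ℝ (w x) (Φ x)
      + inner ℝ (w x) (fderiv ℝ Φ x (u x)) + (1 / 2) * inner ℝ (u x) (curl3 Φ x)
      + inner ℝ (g x) (Φ x)) = 0

/-! This is a bootstrap in local Sobolev spaces. A distribution is here any linear functional `L` on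
test functions, and it has order `s` when `ξ ↦ L (modulate ξ φ)`, the Fourier transform of `φL`, is
square integrable with weight `bracket s` for every cutoff `φ`. Derivatives cost one order
(`LocSobolev.comp_deriv`), inverting the Laplacian regains two (`LocSobolev.of_laplacian`), and in
dimension three a product of two functions of order `s ≥ 1` has order `s - 3/4` (`LocSobolev.mul`).

Suppose `u`, `w` have order `s` and `p` order `s - 3/4`. In the velocity equation the worst terms,
`div (u ⊗ u)` and `∇p`, have order `s - 7/4`, so `u` has order `s + 1/4`. In the microrotation
equation `∇ div w` is as strong as the Laplacian, so `div w` is treated first: the divergence of the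
equation reads `2Δ(div w) =` lower order terms. The divergence of the velocity equation leaves `Δp =
-∑ ∂ₐ∂ⱼ(uₐuⱼ)`, so `p` has the order of `u ⊗ u`. Each round thus gains `1/4`
(`MicropolarSystem.locSobolev_all`).

The start is order `1` for `u`, `w` and `1/4` for `p`: a homogeneous Sobolev space of order `s ≥ 0`
embeds locally in the inhomogeneous one (`LocSobolev.of_inHomSobolev`). At the end, order `s` for
all `s` gives smoothness by Fourier inversion (`exists_contDiff_of_locSobolev`). -/

/-! ### Weighted square integrability -/

/-- The weight `(1 + ‖ξ‖ ^ 2) ^ (s / 2)`. -/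
noncomputable def bracket (s : ℝ) (ξ : E3) : ℝ := (1 + ‖ξ‖ ^ 2) ^ (s / 2)

lemma bracket_pos (s : ℝ) (ξ : E3) : 0 < bracket s ξ := by
  unfold bracket; positivity

lemma bracket_add (s t : ℝ) (ξ : E3) : bracket (s + t) ξ = bracket s ξ * bracket t ξ := by
  unfold bracket
  rw [← Real.rpow_add (by positivity), add_div]

lemma bracket_zero (ξ : E3) : bracket 0 ξ = 1 := by simp [bracket]

lemma bracket_two (ξ : E3) : bracket 2 ξ = 1 + ‖ξ‖ ^ 2 := by simp [bracket]

lemma bracket_neg_mul (s : ℝ) (ξ : E3) : bracket (-s) ξ * bracket s ξ = 1 := by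
  rw [← bracket_add]; simp [bracket_zero]

lemma bracket_mono {s t : ℝ} (h : s ≤ t) (ξ : E3) : bracket s ξ ≤ bracket t ξ := by
  unfold bracket
  exact Real.rpow_le_rpow_of_exponent_le (by nlinarith [sq_nonneg ‖ξ‖]) (by linarith)

lemma one_le_bracket {s : ℝ} (h : 0 ≤ s) (ξ : E3) : 1 ≤ bracket s ξ := by
  simpa [bracket_zero] using bracket_mono h ξ

lemma bracket_mul_self (s : ℝ) (ξ : E3) : bracket s ξ ^ 2 = bracket (2 * s) ξ := by
  rw [two_mul, bracket_add, sq]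

lemma norm_le_bracket_one (ξ : E3) : ‖ξ‖ ≤ bracket 1 ξ := by
  refine le_of_sq_le_sq ?_ (bracket_pos _ _).le
  rw [bracket_mul_self, mul_one, bracket_two]; linarith

lemma continuous_bracket (s : ℝ) : Continuous (bracket s) := by
  unfold bracket
  refine Continuous.rpow_const (by fun_prop) fun ξ => Or.inl (by positivity)

/-- Square integrability with respect to the weight `bracket s`. -/
def WeightedL2 (s : ℝ) (g : E3 → ℂ) : Prop :=
  MemLp (fun ξ => (bracket s ξ : ℂ) * g ξ) 2

namespace WeightedL2

variable {s t : ℝ} {g h : E3 → ℂ}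

lemma aestronglyMeasurable (hg : WeightedL2 s g) : AEStronglyMeasurable g := by
  have h1 : AEStronglyMeasurable (fun ξ => (bracket (-s) ξ : ℂ) * ((bracket s ξ : ℂ) * g ξ)) :=
    ((Complex.continuous_ofReal.comp (continuous_bracket (-s))).aestronglyMeasurable).mul hg.1
  refine h1.congr (Filter.Eventually.of_forall fun ξ => ?_)
  have := bracket_neg_mul s ξ
  simp only [← mul_assoc, ← Complex.ofReal_mul, this, Complex.ofReal_one, one_mul]

lemma add (hg : WeightedL2 s g) (hh : WeightedL2 s h) : WeightedL2 s (fun ξ => g ξ + h ξ) := by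
  unfold WeightedL2
  simp only [mul_add]
  exact MemLp.add hg hh

/-- A Fourier multiplier of order `k` costs `k` orders; `mono` and `const_mul` are the cases of
constant symbols. -/
lemma mul_symbol (hg : WeightedL2 s g) {m : E3 → ℂ} (hm : Continuous m) {k C : ℝ}
    (hb : ∀ ξ, ‖m ξ‖ ≤ C * bracket k ξ) : WeightedL2 (s - k) (fun ξ => m ξ * g ξ) := by
  refine MemLp.of_le_mul (c := C) hg ?_ (Filter.Eventually.of_forall fun ξ => ?_)
  · exact ((Complex.continuous_ofReal.comp (continuous_bracket (s - k))).aestronglyMeasurable).mul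
      (hm.aestronglyMeasurable.mul hg.aestronglyMeasurable)
  · have h1 : bracket s ξ = bracket (s - k) ξ * bracket k ξ := by rw [← bracket_add]; simp
    simp only [norm_mul, Complex.norm_real, Real.norm_eq_abs, abs_of_pos (bracket_pos _ _)]
    rw [h1]
    calc bracket (s - k) ξ * (‖m ξ‖ * ‖g ξ‖)
        ≤ bracket (s - k) ξ * ((C * bracket k ξ) * ‖g ξ‖) := by
          gcongr
          · exact (bracket_pos _ _).le
          · exact hb ξ
      _ = _ := by ring

lemma mono (hg : WeightedL2 s g) (h : t ≤ s) : WeightedL2 t g := by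
  have := hg.mul_symbol (m := fun _ => 1) continuous_const (k := s - t) (C := 1)
    (fun ξ => by simpa using one_le_bracket (sub_nonneg.2 h) ξ)
  simpa using this

lemma const_mul (hg : WeightedL2 s g) (c : ℂ) : WeightedL2 s (fun ξ => c * g ξ) := by
  have := hg.mul_symbol (m := fun _ => c) continuous_const (k := 0) (C := ‖c‖)
    (fun ξ => by simp [bracket_zero])
  simpa using this

lemma sum {ι : Type*} (I : Finset ι) {g : ι → E3 → ℂ} (hg : ∀ i ∈ I, WeightedL2 s (g i)) :
    WeightedL2 s (fun ξ => ∑ i ∈ I, g i ξ) := by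
  unfold WeightedL2
  simp only [Finset.mul_sum]
  exact memLp_finsetSum _ hg

end WeightedL2

/-! ### Test functions and local Sobolev regularity of distributions -/

/-- Complex valued smooth functions with compact support. -/
def testSpace : Submodule ℂ (E3 → ℂ) where
  carrier := {ψ | ContDiff ℝ ∞ ψ ∧ HasCompactSupport ψ}
  add_mem' h k := ⟨h.1.add k.1, h.2.add k.2⟩
  zero_mem' := ⟨contDiff_const, HasCompactSupport.zero⟩
  smul_mem' c _ h := ⟨contDiff_const.smul h.1, h.2.smul_left (f := fun _ => c)⟩

namespace testSpace

lemma continuous (ψ : testSpace) : Continuous (ψ : E3 → ℂ) := ψ.2.1.continuous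

lemma differentiable (ψ : testSpace) : Differentiable ℝ (ψ : E3 → ℂ) :=
  ψ.2.1.differentiable (by simp)

/-- The partial derivative in the `j`-th coordinate direction. -/
noncomputable def deriv (j : Fin 3) : testSpace →ₗ[ℂ] testSpace where
  toFun ψ := ⟨fun x => fderiv ℝ (ψ : E3 → ℂ) x (EuclideanSpace.single j 1),
    (ψ.2.1.fderiv_right (m := ∞) (by simp)).clm_apply contDiff_const,
    ψ.2.2.fderiv_apply ℝ _⟩
  map_add' ψ χ := by
    ext x
    simp [fderiv_add (testSpace.differentiable ψ x) (testSpace.differentiable χ x)]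
  map_smul' c ψ := by
    ext x
    simp [fderiv_const_smul (testSpace.differentiable ψ x) c]

lemma deriv_apply (j : Fin 3) (ψ : testSpace) (x : E3) :
    (deriv j ψ : E3 → ℂ) x = fderiv ℝ (ψ : E3 → ℂ) x (EuclideanSpace.single j 1) := rfl

lemma deriv_comm (i j : Fin 3) (ψ : testSpace) : deriv i (deriv j ψ) = deriv j (deriv i ψ) := by
  have hd : Differentiable ℝ (fderiv ℝ (ψ : E3 → ℂ)) :=
    (ψ.2.1.fderiv_right (m := 1) (by norm_cast)).differentiable (by simp)
  have key : ∀ (i j : Fin 3) (x : E3), (deriv i (deriv j ψ) : E3 → ℂ) x =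
      fderiv ℝ (fderiv ℝ (ψ : E3 → ℂ)) x (EuclideanSpace.single i 1)
        (EuclideanSpace.single j 1) := by
    intro i j x
    have : (deriv j ψ : E3 → ℂ) =
      fun x => fderiv ℝ (ψ : E3 → ℂ) x (EuclideanSpace.single j 1) := rfl
    rw [deriv_apply, this, fderiv_clm_apply (hd x) (differentiableAt_const _)]
    simp
  ext x
  rw [key, key]
  exact (ψ.2.1.contDiffAt.isSymmSndFDerivAt (by simp; norm_cast)) _ _

/-- The oscillating factor of the Fourier transform. -/
noncomputable def wave (ξ x : E3) : ℂ :=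
  Complex.exp (((-2 * Real.pi * inner ℝ x ξ : ℝ) : ℂ) * Complex.I)

lemma contDiff_wave (ξ : E3) : ContDiff ℝ ∞ (wave ξ) := by
  unfold wave
  refine ContDiff.cexp (ContDiff.mul (Complex.ofRealCLM.contDiff.comp ?_) contDiff_const)
  exact contDiff_const.mul (contDiff_id.inner ℝ contDiff_const)

lemma norm_wave (ξ x : E3) : ‖wave ξ x‖ = 1 := Complex.norm_exp_ofReal_mul_I _

lemma fderiv_wave (ξ x v : E3) :
    fderiv ℝ (wave ξ) x v = -(2 * Real.pi * Complex.I * (inner ℝ v ξ : ℝ)) * wave ξ x := by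
  have h1 : HasFDerivAt (fun x : E3 => (-2 * Real.pi * inner ℝ x ξ : ℝ))
      ((-2 * Real.pi) • (innerSL ℝ ξ)) x := by
    have := ((innerSL ℝ ξ).hasFDerivAt (x := x)).const_mul (-2 * Real.pi)
    refine this.congr_of_eventuallyEq (Filter.Eventually.of_forall fun y => ?_)
    simp [real_inner_comm]
  have h2 : HasFDerivAt (wave ξ) _ x :=
    ((Complex.ofRealCLM.hasFDerivAt.comp x h1).mul_const Complex.I).cexp
  rw [h2.fderiv]
  simp [wave, real_inner_comm]
  ring

/-- Multiplication by `wave ξ`. -/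
noncomputable def modulate (ξ : E3) : testSpace →ₗ[ℂ] testSpace where
  toFun ψ := ⟨fun x => wave ξ x * (ψ : E3 → ℂ) x, (contDiff_wave ξ).mul ψ.2.1,
    ψ.2.2.mul_left⟩
  map_add' ψ χ := by ext x; simp [mul_add]
  map_smul' c ψ := by ext x; simp; ring

lemma modulate_apply (ξ : E3) (ψ : testSpace) (x : E3) :
    (modulate ξ ψ : E3 → ℂ) x = wave ξ x * (ψ : E3 → ℂ) x := rfl

/-- A derivative yields a factor linear in `ξ` and a term with the cutoff replaced by its
derivative; hence regularity is required for all cutoffs at once. -/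
lemma deriv_modulate (j : Fin 3) (ξ : E3) (ψ : testSpace) :
    deriv j (modulate ξ ψ) =
      modulate ξ (deriv j ψ) + (-(2 * Real.pi * Complex.I * (ξ j : ℝ))) • modulate ξ ψ := by
  ext x
  have : (modulate ξ ψ : E3 → ℂ) = fun x => wave ξ x * (ψ : E3 → ℂ) x := rfl
  simp only [deriv_apply, this, Submodule.coe_add, Pi.add_apply, modulate_apply, Submodule.coe_smul,
    Pi.smul_apply]
  rw [fderiv_fun_mul ((contDiff_wave ξ).differentiable (by simp) x) (testSpace.differentiable ψ x)]
  simp [fderiv_wave, EuclideanSpace.inner_single_left]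
  ring

end testSpace

/-- A linear functional on test functions. -/
abbrev Distr : Type := testSpace →ₗ[ℂ] ℂ

open testSpace

/-- The Laplacian on test functions. -/
noncomputable def testLaplacian : testSpace →ₗ[ℂ] testSpace := ∑ j, deriv j ∘ₗ deriv j

/-- Local Sobolev regularity of order `s`: the Fourier transform of every localization
is square integrable with weight `bracket s`. -/
def LocSobolev (s : ℝ) (L : Distr) : Prop :=
  ∀ φ : testSpace, WeightedL2 s (fun ξ => L (modulate ξ φ))

namespace LocSobolev

variable {s t : ℝ} {L M : Distr}

lemma add (hL : LocSobolev s L) (hM : LocSobolev s M) : LocSobolev s (L + M) :=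
  fun φ => (hL φ).add (hM φ)

lemma smul (hL : LocSobolev s L) (c : ℂ) : LocSobolev s (c • L) :=
  fun φ => (hL φ).const_mul c

lemma neg (hL : LocSobolev s L) : LocSobolev s (-L) := by
  simpa using hL.smul (-1)

lemma sub (hL : LocSobolev s L) (hM : LocSobolev s M) : LocSobolev s (L - M) := by
  rw [sub_eq_add_neg]; exact hL.add hM.neg

lemma sum {ι : Type*} (I : Finset ι) {L : ι → Distr} (hL : ∀ i ∈ I, LocSobolev s (L i)) :
    LocSobolev s (∑ i ∈ I, L i) := by
  intro φ
  simp only [LinearMap.sum_apply]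
  exact WeightedL2.sum I fun i hi => hL i hi φ

lemma mono (hL : LocSobolev s L) (h : t ≤ s) : LocSobolev t L := fun φ => (hL φ).mono h

lemma coord_symbol (j : Fin 3) : Continuous (fun ξ : E3 => -(2 * Real.pi * Complex.I * (ξ j : ℝ)))
    ∧ ∀ ξ : E3, ‖-(2 * Real.pi * Complex.I * (ξ j : ℝ))‖ ≤ (2 * Real.pi) * bracket 1 ξ := by
  refine ⟨by fun_prop, fun ξ => ?_⟩
  have h1 : ‖ξ j‖ ≤ bracket 1 ξ := (PiLp.norm_apply_le ξ j).trans (norm_le_bracket_one ξ)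
  simp only [norm_neg, norm_mul, Complex.norm_real, Complex.norm_I, mul_one, Complex.norm_ofNat,
    Real.norm_eq_abs, abs_of_pos Real.pi_pos] at h1 ⊢
  gcongr

lemma comp_deriv (hL : LocSobolev s L) (j : Fin 3) : LocSobolev (s - 1) (L ∘ₗ deriv j) := by
  intro φ
  simp only [LinearMap.comp_apply, deriv_modulate, map_add, map_smul, smul_eq_mul]
  exact ((hL _).mono (by linarith)).add
    ((hL φ).mul_symbol (coord_symbol j).1 (coord_symbol j).2)

/-- Elliptic regularity for the Laplacian. -/
lemma of_laplacian (hL : LocSobolev (s - 1) L) (hΔ : LocSobolev (s - 2) (L ∘ₗ testLaplacian)) :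
    LocSobolev s L := by
  intro φ
  -- Expanding the Laplacian of `wave ξ * φ` gives cross terms linear in `ξ`; with `L` of order `s -
  -- 1` they have order `s - 2`.
  have h1 : ∀ j : Fin 3, WeightedL2 (s - 2) fun ξ =>
      -(2 * Real.pi * Complex.I * (ξ j : ℝ)) * L (modulate ξ (deriv j φ)) := by
    intro j
    have := (hL (deriv j φ)).mul_symbol (coord_symbol j).1 (coord_symbol j).2
    exact this.mono (by linarith)
  have h2 : WeightedL2 (s - 2) fun ξ => ∑ j : Fin 3, L (modulate ξ (deriv j (deriv j φ))) :=
    WeightedL2.sum _ fun j _ => (hL _).mono (by linarith)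
  -- The expansion is solved for `‖ξ‖ ^ 2 * L (modulate ξ φ)`; `h4` adds `L (modulate ξ φ)` to
  -- complete the factor `bracket 2`.
  have h3 := ((hΔ φ).add ((h2.add ((WeightedL2.sum Finset.univ
    fun j _ => h1 j).const_mul 2)).const_mul (-1))).const_mul (-(1 / (4 * Real.pi ^ 2)))
  have h4 := h3.add ((hL φ).mono (show s - 2 ≤ s - 1 by linarith))
  have key : ∀ ξ : E3, (-(1 / (4 * Real.pi ^ 2)) : ℂ) * ((L ∘ₗ testLaplacian) (modulate ξ φ) +
      -1 * (∑ j : Fin 3, L (modulate ξ (deriv j (deriv j φ))) +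
        2 * ∑ j : Fin 3, -(2 * Real.pi * Complex.I * (ξ j : ℝ)) * L (modulate ξ (deriv j φ)))) +
      L (modulate ξ φ) = (bracket 2 ξ : ℂ) * L (modulate ξ φ) := by
    intro ξ
    have hpi : (Real.pi : ℂ) ≠ 0 := by exact_mod_cast Real.pi_ne_zero
    have hn : (bracket 2 ξ : ℂ) = 1 + ((ξ 0 : ℝ) : ℂ) ^ 2 + ((ξ 1 : ℝ) : ℂ) ^ 2
        + ((ξ 2 : ℝ) : ℂ) ^ 2 := by
      rw [bracket_two, EuclideanSpace.norm_sq_eq]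
      simp [Fin.sum_univ_three]
      ring
    rw [hn]
    simp only [testLaplacian, Fin.sum_univ_three, LinearMap.comp_apply, LinearMap.add_apply,
      map_add, deriv_modulate, map_smul, smul_eq_mul]
    field_simp
    ring_nf
    simp only [Complex.I_sq]
    ring
  simp only [key] at h4
  unfold WeightedL2 at h4 ⊢
  refine h4.congr_norm ?_ (Filter.Eventually.of_forall fun ξ => ?_)
  · exact ((Complex.continuous_ofReal.comp (continuous_bracket s)).aestronglyMeasurable).mul
      (hL φ).aestronglyMeasurable
  · rw [← mul_assoc, ← Complex.ofReal_mul, ← bracket_add]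
    simp

end LocSobolev

/-! ### Distributions given by functions -/

lemma integrable_ofReal_mul_test {F : E3 → ℝ} (hF : LocallyIntegrable F) (ψ : testSpace) :
    Integrable (fun x => (F x : ℂ) * (ψ : E3 → ℂ) x) := by
  have h1 : LocallyIntegrable (fun x => (F x : ℂ)) := fun x => by
    obtain ⟨U, hU, h⟩ := hF x
    exact ⟨U, hU, h.ofReal⟩
  have := h1.integrable_smul_left_of_hasCompactSupport (continuous ψ) ψ.2.2
  simpa [mul_comm] using this

/-- The distribution defined by a locally integrable function. -/
noncomputable def ofFun (F : E3 → ℝ) (hF : LocallyIntegrable F) : Distr where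
  toFun ψ := ∫ x, (F x : ℂ) * (ψ : E3 → ℂ) x
  map_add' ψ χ := by
    simp only [Submodule.coe_add, Pi.add_apply, mul_add]
    exact integral_add (integrable_ofReal_mul_test hF ψ) (integrable_ofReal_mul_test hF χ)
  map_smul' c ψ := by
    simp only [Submodule.coe_smul, Pi.smul_apply, smul_eq_mul, RingHom.id_apply,
      ← integral_const_mul]
    congr 1; ext x; ring

lemma ofFun_apply {F : E3 → ℝ} (hF : LocallyIntegrable F) (ψ : testSpace) :
    ofFun F hF ψ = ∫ x, (F x : ℂ) * (ψ : E3 → ℂ) x := rfl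

lemma fourier_eq_integral_wave (f : E3 → ℂ) (ξ : E3) : 𝓕 f ξ = ∫ x, wave ξ x * f x := by
  rw [Real.fourier_eq']
  rfl

lemma ofFun_modulate {F : E3 → ℝ} (hF : LocallyIntegrable F) (φ : testSpace) (ξ : E3) :
    ofFun F hF (modulate ξ φ) = 𝓕 (fun x => (F x : ℂ) * (φ : E3 → ℂ) x) ξ := by
  rw [ofFun_apply, fourier_eq_integral_wave]
  congr 1; ext x
  rw [modulate_apply]; ring

/-- A test function as a Schwartz function. -/
noncomputable def testSpace.toSchwartz (ψ : testSpace) : 𝓢(E3, ℂ) :=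
  HasCompactSupport.toSchwartzMap ψ.2.2 ψ.2.1

lemma weightedL2_schwartz (s : ℝ) (f : 𝓢(E3, ℂ)) : WeightedL2 s f := by
  have h : (fun ξ : E3 => (bracket s ξ : ℂ)).HasTemperateGrowth := by
    unfold bracket
    fun_prop
  have := (SchwartzMap.smulLeftCLM ℂ (fun ξ : E3 => (bracket s ξ : ℂ)) f).memLp 2 volume
  rw [SchwartzMap.smulLeftCLM_apply h] at this
  simpa [WeightedL2] using this

lemma LocSobolev.of_contDiff {F : E3 → ℝ} (hF : LocallyIntegrable F) (h : ContDiff ℝ ∞ F)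
    (s : ℝ) : LocSobolev s (ofFun F hF) := by
  intro φ
  simp only [ofFun_modulate]
  have h1 : ContDiff ℝ ∞ (fun x => (F x : ℂ) * (φ : E3 → ℂ) x) :=
    (Complex.ofRealCLM.contDiff.comp h).mul φ.2.1
  have h2 : HasCompactSupport (fun x => (F x : ℂ) * (φ : E3 → ℂ) x) := φ.2.2.mul_left
  exact weightedL2_schwartz s (𝓕 (h2.toSchwartzMap h1))

/-! ### Fourier inversion, and smoothness from regularity of every order -/

lemma integral_fourier_mul {f g : E3 → ℂ} (hf : Integrable f) (hg : Integrable g) :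
    ∫ ξ, 𝓕 f ξ * g ξ = ∫ x, f x * 𝓕 g x := by
  have := VectorFourier.integral_fourierIntegral_smul_eq_flip (L := innerₗ E3)
    Real.continuous_fourierChar continuous_inner hf hg
  simpa using! this

lemma ae_eq_of_integral_test {f g : E3 → ℂ} (hf : LocallyIntegrable f) (hg : LocallyIntegrable g)
    (h : ∀ ψ : testSpace, ∫ x, f x * (ψ : E3 → ℂ) x = ∫ x, g x * (ψ : E3 → ℂ) x) :
    f =ᵐ[volume] g := by
  refine ae_eq_of_integral_contDiff_smul_eq hf hg fun θ h1 h2 => ?_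
  have h3 := h ⟨fun x => (θ x : ℂ), Complex.ofRealCLM.contDiff.comp h1,
    h2.comp_left (g := Complex.ofReal) (by simp)⟩
  simpa [mul_comm] using h3

/-- As `f` need not be continuous, equality is tested: the multiplication formula moves both
transforms onto a Schwartz function, where inversion is known. -/
lemma ae_eq_fourierInv_fourier {f : E3 → ℂ} (hf : Integrable f) (hg : Integrable (𝓕 f)) :
    f =ᵐ[volume] 𝓕⁻ (𝓕 f) := by
  have hc : Continuous (𝓕⁻ (𝓕 f)) := by
    rw [Real.fourierInv_eq_fourier_comp_neg]
    exact VectorFourier.fourierIntegral_continuous Real.continuous_fourierChar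
      (L := innerₗ E3) continuous_inner hg.comp_neg
  refine ae_eq_of_integral_test hf.locallyIntegrable hc.locallyIntegrable fun ψ => ?_
  set Ψ := toSchwartz ψ
  have h1 : ∫ x, 𝓕⁻ (𝓕 f) x * Ψ x = ∫ ξ, 𝓕 f ξ * 𝓕⁻ (Ψ : E3 → ℂ) ξ := by
    have := integral_fourier_mul hg.comp_neg Ψ.integrable
    rw [Real.fourierInv_eq_fourier_comp_neg]
    refine this.trans ?_
    rw [← integral_neg_eq_self]
    simp [Real.fourierInv_eq_fourier_neg]
  have h2 : 𝓕 (𝓕⁻ Ψ) = Ψ := FourierTransform.fourier_fourierInv_eq Ψ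
  have h3 := integral_fourier_mul hf (𝓕⁻ Ψ).integrable
  change _ = ∫ x, 𝓕⁻ (𝓕 f) x * Ψ x
  rw [h1, ← SchwartzMap.fourierInv_coe, h3, ← SchwartzMap.fourier_coe, h2]
  rfl

lemma memLp_bracket_neg_two : MemLp (fun ξ : E3 => bracket (-2) ξ) 2 := by
  rw [memLp_two_iff_integrable_sq (continuous_bracket _).aestronglyMeasurable]
  have := integrable_rpow_neg_one_add_norm_sq (E := E3) (μ := volume) (r := 4)
    (by simp; norm_num)
  refine this.congr (Filter.Eventually.of_forall fun ξ => ?_)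
  simp only [bracket_mul_self]
  simp [bracket]; norm_num

/-- Cauchy–Schwarz against `bracket (-2)`, which is square integrable because `4 > 3`; this explains
the `+ 2`. -/
lemma WeightedL2.integrable_pow {g : E3 → ℂ} {n : ℕ} (hg : WeightedL2 (n + 2) g) :
    Integrable (fun ξ => ‖ξ‖ ^ n * ‖g ξ‖) := by
  have h1 := (memLp_bracket_neg_two.ofReal (K := ℂ)).integrable_mul hg
  refine Integrable.mono' h1.norm ?_ (Filter.Eventually.of_forall fun ξ => ?_)
  · exact (by fun_prop : Continuous fun ξ : E3 => ‖ξ‖ ^ n).aestronglyMeasurable.mul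
      hg.aestronglyMeasurable.norm
  · have h2 : bracket (-2) ξ * bracket (n + 2) ξ = bracket n ξ := by
      rw [← bracket_add]; ring_nf
    have h3 : ‖ξ‖ ^ n ≤ bracket n ξ := by
      have h4 : bracket n ξ = bracket 1 ξ ^ n := by
        unfold bracket
        rw [← Real.rpow_mul_natCast (by positivity)]
        ring_nf
      rw [h4]
      gcongr
      exact norm_le_bracket_one ξ
    simp only [Pi.mul_apply, norm_mul, RCLike.norm_ofReal, Complex.norm_real, Real.norm_eq_abs,
      abs_of_pos (bracket_pos _ _), abs_norm, abs_pow]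
    rw [← mul_assoc, h2]
    gcongr

/-- All moments of the Fourier transform of `φF` are integrable, so its inverse transform can be
differentiated under the integral to any order. -/
lemma exists_contDiff_localization {F : E3 → ℝ} (hF : LocallyIntegrable F)
    (h : ∀ s, LocSobolev s (ofFun F hF)) (φ : testSpace) :
    ∃ G : E3 → ℂ, ContDiff ℝ ∞ G ∧ (fun x => (F x : ℂ) * (φ : E3 → ℂ) x) =ᵐ[volume] G := by
  set f : E3 → ℂ := fun x => (F x : ℂ) * (φ : E3 → ℂ) x with hf
  have hw : ∀ s, WeightedL2 s (𝓕 f) := fun s => by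
    have := h s φ
    simpa only [ofFun_modulate] using this
  have hi : ∀ n : ℕ, Integrable (fun ξ => ‖ξ‖ ^ n * ‖𝓕 f ξ‖) := fun n => (hw _).integrable_pow
  have hm : AEStronglyMeasurable (𝓕 f) := (hw 0).aestronglyMeasurable
  have hint : Integrable (𝓕 f) := by
    rw [← integrable_norm_iff hm]
    simpa using hi 0
  refine ⟨𝓕⁻ (𝓕 f), ?_, ae_eq_fourierInv_fourier (integrable_ofReal_mul_test hF φ) hint⟩
  rw [Real.fourierInv_eq_fourier_comp_neg]
  refine Real.contDiff_fourier (N := ⊤) fun n _ => ?_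
  have := (hi n).comp_neg
  simpa using this

/-- Smooth versions on balls glue, since continuous functions equal almost everywhere on an open set
agree there. -/
lemma exists_contDiff_of_locSobolev {F : E3 → ℝ} (hF : LocallyIntegrable F)
    (h : ∀ s, LocSobolev s (ofFun F hF)) :
    ∃ F' : E3 → ℝ, F =ᵐ[volume] F' ∧ ContDiff ℝ ∞ F' := by
  have hloc : ∀ n : ℕ, ∃ G : E3 → ℝ, ContDiff ℝ ∞ G ∧
      ∀ᵐ x, x ∈ Metric.ball (0 : E3) n → F x = G x := by
    intro n
    let b : ContDiffBump (0 : E3) := ⟨n + 1, n + 2, by positivity, by linarith⟩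
    obtain ⟨G, hG, hae⟩ := exists_contDiff_localization hF h
      ⟨fun x => (b x : ℂ), Complex.ofRealCLM.contDiff.comp b.contDiff,
        b.hasCompactSupport.comp_left (g := Complex.ofReal) (by simp)⟩
    refine ⟨fun x => (G x).re, Complex.reCLM.contDiff.comp hG, ?_⟩
    filter_upwards [hae] with x hx hxn
    have h1 : b x = 1 := b.one_of_mem_closedBall
      (Metric.closedBall_subset_closedBall (by simp [b]) (Metric.ball_subset_closedBall hxn))
    simp only [h1, Complex.ofReal_one, mul_one] at hx
    rw [← hx, Complex.ofReal_re]
  choose G hG hae using hloc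
  have hcomp : ∀ (m n : ℕ) (x : E3), x ∈ Metric.ball (0 : E3) m → x ∈ Metric.ball (0 : E3) n →
      G m x = G n x := by
    intro m n x hm hn
    have hU : IsOpen (Metric.ball (0 : E3) m ∩ Metric.ball (0 : E3) n) :=
      Metric.isOpen_ball.inter Metric.isOpen_ball
    refine Measure.eqOn_open_of_ae_eq (μ := volume) ?_ hU (hG m).continuous.continuousOn
      (hG n).continuous.continuousOn ⟨hm, hn⟩
    rw [Filter.EventuallyEq, ae_restrict_iff' hU.measurableSet]
    filter_upwards [hae m, hae n] with y h1 h2 hy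
    rw [← h1 hy.1, h2 hy.2]
  -- The `+ 1` puts `x` in the open ball. The index jumps with `x`, which `hcomp` makes harmless.
  have hmem : ∀ x : E3, x ∈ Metric.ball (0 : E3) ((⌈‖x‖⌉₊ + 1 : ℕ) : ℝ) := by
    intro x
    rw [mem_ball_zero_iff]
    push_cast
    linarith [Nat.le_ceil ‖x‖]
  refine ⟨fun x => G (⌈‖x‖⌉₊ + 1) x, ?_, ?_⟩
  · filter_upwards [ae_all_iff.2 hae] with x hx
    exact hx _ (hmem x)
  · rw [contDiff_iff_contDiffAt]
    intro x
    refine (hG (⌈‖x‖⌉₊ + 1)).contDiffAt.congr_of_eventuallyEq ?_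
    filter_upwards [Metric.isOpen_ball.mem_nhds (hmem x)] with y hy
    exact hcomp _ _ y (hmem y) hy

section

open scoped ENNReal

/-! ### Weighted convolution estimates -/

/-- The weight `bracket s` with values in `ℝ≥0∞`. -/
noncomputable def eBracket (s : ℝ) (ξ : E3) : ℝ≥0∞ := ENNReal.ofReal (bracket s ξ)

lemma measurable_eBracket (s : ℝ) : Measurable (eBracket s) :=
  (continuous_bracket s).measurable.ennreal_ofReal

lemma eBracket_add (s t : ℝ) (ξ : E3) : eBracket (s + t) ξ = eBracket s ξ * eBracket t ξ := by
  unfold eBracket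
  rw [bracket_add, ENNReal.ofReal_mul (bracket_pos _ _).le]

lemma eBracket_neg_mul (s : ℝ) (ξ : E3) : eBracket (-s) ξ * eBracket s ξ = 1 := by
  rw [← eBracket_add]; simp [eBracket, bracket_zero]

lemma eBracket_sq (s : ℝ) (ξ : E3) : eBracket s ξ ^ 2 = eBracket (2 * s) ξ := by
  rw [two_mul, eBracket_add, sq]

lemma weightedL2_iff {s : ℝ} {g : E3 → ℂ} :
    WeightedL2 s g ↔ AEStronglyMeasurable g ∧ ∫⁻ ξ, (eBracket s ξ * ‖g ξ‖ₑ) ^ 2 < ⊤ := by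
  have key : ∀ ξ, ‖(bracket s ξ : ℂ) * g ξ‖ₑ = eBracket s ξ * ‖g ξ‖ₑ := fun ξ => by
    rw [enorm_mul, ← ofReal_norm, Complex.norm_real, Real.norm_eq_abs,
      abs_of_pos (bracket_pos _ _)]
    rfl
  have h2 : eLpNorm (fun ξ => (bracket s ξ : ℂ) * g ξ) 2 volume < ⊤ ↔
      ∫⁻ ξ, (eBracket s ξ * ‖g ξ‖ₑ) ^ 2 < ⊤ := by
    rw [eLpNorm_lt_top_iff_lintegral_rpow_enorm_lt_top (by norm_num) (by norm_num)]
    simp [key]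
  constructor
  · intro h
    exact ⟨h.aestronglyMeasurable, h2.1 h.2⟩
  · rintro ⟨h, h'⟩
    exact ⟨((Complex.continuous_ofReal.comp (continuous_bracket s)).aestronglyMeasurable).mul h,
      h2.2 h'⟩

lemma lintegral_mul_sq_le {A B : E3 → ℝ≥0∞} (hA : AEMeasurable A) (hB : AEMeasurable B) :
    (∫⁻ x, A x * B x) ^ 2 ≤ (∫⁻ x, A x ^ 2) * ∫⁻ x, B x ^ 2 := by
  have h := ENNReal.lintegral_mul_le_Lp_mul_Lq volume Real.HolderConjugate.two_two hA hB
  simp only [Pi.mul_apply, ENNReal.rpow_two] at h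
  calc (∫⁻ x, A x * B x) ^ 2
      ≤ ((∫⁻ x, A x ^ 2) ^ (1 / 2 : ℝ) * (∫⁻ x, B x ^ 2) ^ (1 / 2 : ℝ)) ^ 2 := by gcongr
    _ = _ := by
      rw [mul_pow, ← ENNReal.rpow_natCast, ← ENNReal.rpow_natCast, ← ENNReal.rpow_mul,
        ← ENNReal.rpow_mul]
      norm_num

/-- Schur type bound for convolutions of weighted square integrable functions. -/
lemma lintegral_convolution_sq_lt_top {A B : E3 → ℝ≥0∞} (hA : AEMeasurable A) (hB : AEMeasurable B)
    {α β τ : ℝ} (hA2 : ∫⁻ η, (eBracket α η * A η) ^ 2 < ⊤)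
    (hB2 : ∫⁻ η, (eBracket β η * B η) ^ 2 < ⊤) {C : ℝ≥0∞} (hC : C < ⊤)
    (hker : ∀ ξ, ∫⁻ η, eBracket (2 * τ) ξ * (eBracket (-(2 * α)) η * eBracket (-(2 * β)) (ξ - η))
      ≤ C) :
    ∫⁻ ξ, (eBracket τ ξ * ∫⁻ η, A η * B (ξ - η)) ^ 2 < ⊤ := by
  have hBs : ∀ ξ : E3, AEMeasurable (fun η => B (ξ - η)) := fun ξ =>
    hB.comp_quasiMeasurePreserving (Measure.measurePreserving_sub_left volume ξ).quasiMeasurePreserving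
  have hbs : ∀ (γ : ℝ) (ξ : E3), Measurable (fun η => eBracket γ (ξ - η)) := fun γ ξ =>
    (measurable_eBracket γ).comp (measurable_const.sub measurable_id)
  -- The weights of orders `-α` and `-β` and their inverses are inserted before Cauchy–Schwarz in
  -- `η`; the kernel factor is then bounded by `C` uniformly in `ξ`.
  have hpt : ∀ ξ, (eBracket τ ξ * ∫⁻ η, A η * B (ξ - η)) ^ 2 ≤
      C * ∫⁻ η, (eBracket α η * A η) ^ 2 * (eBracket β (ξ - η) * B (ξ - η)) ^ 2 := by
    intro ξ
    have e1 : ∀ η, A η * B (ξ - η) = (eBracket (-α) η * eBracket (-β) (ξ - η)) *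
        ((eBracket α η * A η) * (eBracket β (ξ - η) * B (ξ - η))) := by
      intro η
      calc A η * B (ξ - η) = (eBracket (-α) η * eBracket α η) *
          (eBracket (-β) (ξ - η) * eBracket β (ξ - η)) * (A η * B (ξ - η)) := by
            rw [eBracket_neg_mul, eBracket_neg_mul, one_mul, one_mul]
        _ = _ := by ring
    have h1 := lintegral_mul_sq_le
      (A := fun η => eBracket (-α) η * eBracket (-β) (ξ - η))
      (B := fun η => (eBracket α η * A η) * (eBracket β (ξ - η) * B (ξ - η)))
      ((measurable_eBracket _).mul (hbs _ ξ)).aemeasurable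
      (((measurable_eBracket _).aemeasurable.mul hA).mul ((hbs _ ξ).aemeasurable.mul (hBs ξ)))
    simp only [← e1, mul_pow, eBracket_sq] at h1
    rw [mul_pow, eBracket_sq]
    calc eBracket (2 * τ) ξ * (∫⁻ η, A η * B (ξ - η)) ^ 2
        ≤ eBracket (2 * τ) ξ * ((∫⁻ η, eBracket (2 * -α) η * eBracket (2 * -β) (ξ - η)) *
          ∫⁻ η, (eBracket (2 * α) η * A η ^ 2) *
            (eBracket (2 * β) (ξ - η) * B (ξ - η) ^ 2)) := by gcongr
      _ = (∫⁻ η, eBracket (2 * τ) ξ * (eBracket (-(2 * α)) η * eBracket (-(2 * β)) (ξ - η))) *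
          ∫⁻ η, (eBracket (2 * α) η * A η ^ 2) *
            (eBracket (2 * β) (ξ - η) * B (ξ - η) ^ 2) := by
          rw [lintegral_const_mul' (eBracket (2 * τ) ξ) _ ENNReal.ofReal_ne_top, mul_assoc]
          simp only [mul_neg]
      _ ≤ C * _ := by
          simp only [mul_pow, eBracket_sq]
          gcongr
          exact hker ξ
  have hP : AEMeasurable (fun η => (eBracket α η * A η) ^ 2) :=
    ((measurable_eBracket _).aemeasurable.mul hA).pow_const 2
  have hQ : AEMeasurable (fun η => (eBracket β η * B η) ^ 2) :=
    ((measurable_eBracket _).aemeasurable.mul hB).pow_const 2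
  have hmeas : AEMeasurable (Function.uncurry fun ξ η : E3 =>
      (eBracket α η * A η) ^ 2 * (eBracket β (ξ - η) * B (ξ - η)) ^ 2)
      ((volume : Measure E3).prod volume) := by
    refine AEMeasurable.mul ?_ ?_
    · exact hP.comp_quasiMeasurePreserving Measure.quasiMeasurePreserving_snd
    · exact hQ.comp_quasiMeasurePreserving (quasiMeasurePreserving_sub volume volume)
  calc ∫⁻ ξ, (eBracket τ ξ * ∫⁻ η, A η * B (ξ - η)) ^ 2
      ≤ ∫⁻ ξ, C * ∫⁻ η, (eBracket α η * A η) ^ 2 * (eBracket β (ξ - η) * B (ξ - η)) ^ 2 :=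
        lintegral_mono hpt
    _ = C * ∫⁻ ξ, ∫⁻ η, (eBracket α η * A η) ^ 2 * (eBracket β (ξ - η) * B (ξ - η)) ^ 2 :=
        lintegral_const_mul' _ _ hC.ne
    -- By Tonelli and translation invariance the double integral factors.
    _ = C * ∫⁻ η, ∫⁻ ξ, (eBracket α η * A η) ^ 2 * (eBracket β (ξ - η) * B (ξ - η)) ^ 2 := by
        rw [lintegral_lintegral_swap hmeas]
    _ = C * ∫⁻ η, (eBracket α η * A η) ^ 2 * ∫⁻ ξ, (eBracket β ξ * B ξ) ^ 2 := by
        congr 2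
        ext η
        have hQη : AEMeasurable (fun ξ => (eBracket β (ξ - η) * B (ξ - η)) ^ 2) :=
          hQ.comp_quasiMeasurePreserving
            (measurePreserving_sub_right volume η).quasiMeasurePreserving
        rw [lintegral_const_mul'' _ hQη,
          lintegral_sub_right_eq_self (fun ξ => (eBracket β ξ * B ξ) ^ 2)]
    _ = C * ((∫⁻ η, (eBracket α η * A η) ^ 2) * ∫⁻ ξ, (eBracket β ξ * B ξ) ^ 2) := by
        rw [lintegral_mul_const'' _ hP]
    _ < ⊤ := ENNReal.mul_lt_top hC (ENNReal.mul_lt_top hA2 hB2)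

lemma lintegral_eBracket_lt_top {r : ℝ} (hr : 3 < r) : ∫⁻ η, eBracket (-r) η < ⊤ := by
  have := integrable_rpow_neg_one_add_norm_sq (E := E3) (μ := volume) (r := r) (by simpa using hr)
  exact this.lintegral_lt_top

lemma lintegral_eBracket_sub (r : ℝ) (ξ : E3) :
    ∫⁻ η, eBracket r (ξ - η) = ∫⁻ η, eBracket r η :=
  lintegral_sub_left_eq_self _ ξ

lemma bracket_two_le (ξ η : E3) (h : ‖ξ - η‖ ≤ ‖η‖) {t : ℝ} (ht : 0 ≤ t) :
    bracket t ξ ≤ 2 ^ t * bracket t η := by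
  unfold bracket
  have h1 : ‖ξ‖ ≤ 2 * ‖η‖ := by
    calc ‖ξ‖ = ‖(ξ - η) + η‖ := by simp
      _ ≤ ‖ξ - η‖ + ‖η‖ := norm_add_le _ _
      _ ≤ _ := by linarith
  have h2 : (2 : ℝ) ^ t = 4 ^ (t / 2) := by
    rw [show (4 : ℝ) = 2 ^ (2 : ℝ) by norm_num, ← Real.rpow_mul (by norm_num)]
    ring_nf
  rw [h2, ← Real.mul_rpow (by norm_num) (by positivity)]
  refine Real.rpow_le_rpow (by positivity) ?_ (by positivity)
  nlinarith [norm_nonneg ξ, norm_nonneg η]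

lemma bracket_anti {η ζ : E3} (h : ‖ζ‖ ≤ ‖η‖) {t : ℝ} (ht : t ≤ 0) :
    bracket t η ≤ bracket t ζ := by
  unfold bracket
  refine Real.rpow_le_rpow_of_nonpos (by positivity) (by gcongr) (by linarith)

/-- The larger of `η` and `ξ - η` absorbs the weight in `ξ`. What remains on it has exponent `2τ -
2α ≤ 0`, so it passes to the smaller one; the sum covers both cases. -/
lemma bracket_kernel_le {α τ : ℝ} (hτ : 0 ≤ τ) (h : τ ≤ α) (ξ η : E3) :
    bracket (2 * τ) ξ * (bracket (-(2 * α)) η * bracket (-(2 * α)) (ξ - η)) ≤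
      2 ^ (2 * τ) * (bracket (-(4 * α - 2 * τ)) η + bracket (-(4 * α - 2 * τ)) (ξ - η)) := by
  have main : ∀ η ζ : E3, ‖ζ‖ ≤ ‖η‖ → bracket (2 * τ) (η + ζ) *
      (bracket (-(2 * α)) η * bracket (-(2 * α)) ζ) ≤
      2 ^ (2 * τ) * bracket (-(4 * α - 2 * τ)) ζ := by
    intro η ζ hζ
    have h1 := bracket_two_le (η + ζ) η (by simpa using hζ) (t := 2 * τ) (by linarith)
    have h2 := bracket_anti hζ (t := 2 * τ - 2 * α) (by linarith)
    calc bracket (2 * τ) (η + ζ) * (bracket (-(2 * α)) η * bracket (-(2 * α)) ζ)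
        ≤ (2 ^ (2 * τ) * bracket (2 * τ) η) * (bracket (-(2 * α)) η * bracket (-(2 * α)) ζ) := by
          gcongr
          exact mul_nonneg (bracket_pos _ _).le (bracket_pos _ _).le
      _ = 2 ^ (2 * τ) * (bracket (2 * τ - 2 * α) η * bracket (-(2 * α)) ζ) := by
          rw [sub_eq_add_neg, bracket_add]; ring
      _ ≤ 2 ^ (2 * τ) * (bracket (2 * τ - 2 * α) ζ * bracket (-(2 * α)) ζ) := by
          gcongr
          exact (bracket_pos _ _).le
      _ = _ := by rw [← bracket_add]; ring_nf
  have hp : (0 : ℝ) ≤ 2 ^ (2 * τ) := by positivity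
  rcases le_total ‖ξ - η‖ ‖η‖ with hle | hle
  · have := main η (ξ - η) hle
    rw [add_sub_cancel] at this
    nlinarith [bracket_pos (-(4 * α - 2 * τ)) η, mul_nonneg hp (bracket_pos (-(4 * α - 2 * τ)) η).le]
  · have := main (ξ - η) η hle
    rw [sub_add_cancel, mul_comm (bracket _ (ξ - η))] at this
    nlinarith [mul_nonneg hp (bracket_pos (-(4 * α - 2 * τ)) (ξ - η)).le]

/-- The kernel bound behind the product estimate. -/
lemma exists_kernel_bound {α τ : ℝ} (hτ : 0 ≤ τ) (h : τ ≤ α) (h3 : 3 < 4 * α - 2 * τ) :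
    ∃ C < ⊤, ∀ ξ, ∫⁻ η, eBracket (2 * τ) ξ *
      (eBracket (-(2 * α)) η * eBracket (-(2 * α)) (ξ - η)) ≤ C := by
  set I := ∫⁻ η, eBracket (-(4 * α - 2 * τ)) η with hI
  refine ⟨ENNReal.ofReal (2 ^ (2 * τ)) * (I + I), ?_, fun ξ => ?_⟩
  · have := lintegral_eBracket_lt_top h3
    exact ENNReal.mul_lt_top ENNReal.ofReal_lt_top (ENNReal.add_lt_top.2 ⟨this, this⟩)
  · calc ∫⁻ η, eBracket (2 * τ) ξ * (eBracket (-(2 * α)) η * eBracket (-(2 * α)) (ξ - η))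
        ≤ ∫⁻ η, ENNReal.ofReal (2 ^ (2 * τ)) * (eBracket (-(4 * α - 2 * τ)) η +
          eBracket (-(4 * α - 2 * τ)) (ξ - η)) := by
          refine lintegral_mono fun η => ?_
          have := ENNReal.ofReal_le_ofReal (bracket_kernel_le hτ h ξ η)
          rwa [ENNReal.ofReal_mul (bracket_pos _ _).le, ENNReal.ofReal_mul (bracket_pos _ _).le,
            ENNReal.ofReal_mul (by positivity),
            ENNReal.ofReal_add (bracket_pos _ _).le (bracket_pos _ _).le] at this
      _ = _ := by
          rw [lintegral_const_mul' _ _ ENNReal.ofReal_ne_top,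
            lintegral_add_left (measurable_eBracket _), lintegral_eBracket_sub]

/-- Peetre's inequality. -/
lemma bracket_le_mul {s : ℝ} (hs : 0 ≤ s) (ξ η : E3) :
    bracket s ξ ≤ 2 ^ s * (bracket s η * bracket s (ξ - η)) := by
  rcases le_total ‖ξ - η‖ ‖η‖ with hle | hle
  · refine (bracket_two_le ξ η hle hs).trans ?_
    have := one_le_bracket hs (ξ - η)
    gcongr
    nlinarith [bracket_pos s η]
  · have h1 := bracket_two_le ξ (ξ - η) (by simpa using hle) hs
    refine h1.trans ?_
    have := one_le_bracket hs η
    gcongr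
    nlinarith [bracket_pos s (ξ - η)]

/-- Peetre's inequality cancels the weights in `ξ` and `η`, leaving the integrable `bracket (-4) (ξ
- η)`. So convolution with a Schwartz function preserves order `s`. -/
lemma exists_kernel_bound_schwartz {s : ℝ} (hs : 0 ≤ s) :
    ∃ C < ⊤, ∀ ξ, ∫⁻ η, eBracket (2 * s) ξ *
      (eBracket (-(2 * s)) η * eBracket (-(2 * (s + 2))) (ξ - η)) ≤ C := by
  refine ⟨ENNReal.ofReal (2 ^ (2 * s)) * ∫⁻ η, eBracket (-(4 : ℝ)) η,
    ENNReal.mul_lt_top ENNReal.ofReal_lt_top (lintegral_eBracket_lt_top (by norm_num)),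
    fun ξ => ?_⟩
  rw [← lintegral_eBracket_sub (-4) ξ, ← lintegral_const_mul' _ _ ENNReal.ofReal_ne_top]
  refine lintegral_mono fun η => ?_
  unfold eBracket
  rw [← ENNReal.ofReal_mul (bracket_pos _ _).le, ← ENNReal.ofReal_mul (bracket_pos _ _).le,
    ← ENNReal.ofReal_mul (by positivity)]
  refine ENNReal.ofReal_le_ofReal ?_
  have h1 := bracket_le_mul (s := 2 * s) (by linarith) ξ η
  have e1 := bracket_neg_mul (2 * s) η
  have e2 : bracket (2 * s) (ξ - η) * bracket (-(2 * (s + 2))) (ξ - η) = bracket (-4) (ξ - η) := by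
    rw [← bracket_add]; ring_nf
  calc bracket (2 * s) ξ * (bracket (-(2 * s)) η * bracket (-(2 * (s + 2))) (ξ - η))
      ≤ (2 ^ (2 * s) * (bracket (2 * s) η * bracket (2 * s) (ξ - η))) *
        (bracket (-(2 * s)) η * bracket (-(2 * (s + 2))) (ξ - η)) := by
        gcongr
        exact mul_nonneg (bracket_pos _ _).le (bracket_pos _ _).le
    _ = 2 ^ (2 * s) * ((bracket (-(2 * s)) η * bracket (2 * s) η) *
        (bracket (2 * s) (ξ - η) * bracket (-(2 * (s + 2))) (ξ - η))) := by ring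
    _ = _ := by rw [e1, e2, one_mul]

/-! ### Products -/

lemma continuous_fourier {f : E3 → ℂ} (hf : Integrable f) : Continuous (𝓕 f) :=
  VectorFourier.fourierIntegral_continuous Real.continuous_fourierChar
    (L := innerₗ E3) continuous_inner hf

/-- The Plancherel extension and the Fourier integral agree on `L¹ ∩ L²`, by pairing with test
functions. -/
lemma coeFn_fourier_toLp {f : E3 → ℂ} (hf : Integrable f) (hf2 : MemLp f 2) :
    (𝓕 (hf2.toLp f) : Lp ℂ 2 (volume : Measure E3)) =ᵐ[volume] 𝓕 f := by
  refine ae_eq_of_integral_test ((Lp.memLp _).locallyIntegrable (by norm_num))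
    (continuous_fourier hf).locallyIntegrable fun ψ => ?_
  have h1 := congrArg (fun T : 𝓢'(E3, ℂ) => T (toSchwartz ψ))
    (Lp.fourier_toTemperedDistribution_eq (hf2.toLp f))
  simp only [TemperedDistribution.fourier_apply, Lp.toTemperedDistribution_apply] at h1
  have h2 := integral_fourier_mul hf (toSchwartz ψ).integrable
  have h3 : ∫ x, (𝓕 (toSchwartz ψ)) x • (hf2.toLp f) x = ∫ x, f x * 𝓕 (toSchwartz ψ : E3 → ℂ) x := by
    refine integral_congr_ae ?_
    filter_upwards [hf2.coeFn_toLp] with x hx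
    rw [hx, smul_eq_mul, mul_comm, SchwartzMap.fourier_coe]
  rw [h3, ← h2] at h1
  rw [show (∫ x, 𝓕 f x * (ψ : E3 → ℂ) x) = ∫ ξ, 𝓕 f ξ * toSchwartz ψ ξ from rfl, h1]
  exact integral_congr_ae (Filter.Eventually.of_forall fun x => mul_comm _ _)

lemma wave_conj (ξ x : E3) : (starRingEnd ℂ) (wave ξ x) = wave (-ξ) x := by
  unfold wave
  rw [← Complex.exp_conj, map_mul, Complex.conj_ofReal, Complex.conj_I, inner_neg_right]
  push_cast
  ring_nf

lemma wave_add (ξ η x : E3) : wave (ξ + η) x = wave ξ x * wave η x := by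
  unfold wave
  rw [← Complex.exp_add]
  congr 1
  rw [inner_add_right]
  push_cast
  ring

lemma continuous_wave (ξ : E3) : Continuous (wave ξ) := (contDiff_wave ξ).continuous

/-- Parseval's identity for `f` and `k`, the conjugate of `wave ξ * g`, whose transform at `η` is
the conjugate of `𝓕 g (ξ - η)`. -/
lemma fourier_mul_eq_convolution {f g : E3 → ℂ} (hf : Integrable f) (hf2 : MemLp f 2)
    (hg : Integrable g) (hg2 : MemLp g 2) (ξ : E3) :
    𝓕 (fun x => f x * g x) ξ = ∫ η, 𝓕 f η * 𝓕 g (ξ - η) := by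
  set k : E3 → ℂ := fun x => (starRingEnd ℂ) (wave ξ x * g x) with hk
  have hkm : AEStronglyMeasurable k := Complex.continuous_conj.comp_aestronglyMeasurable
    ((continuous_wave ξ).aestronglyMeasurable.mul hg.1)
  have hkn : ∀ x, ‖k x‖ = ‖g x‖ := fun x => by simp [hk, norm_wave]
  have hk1 : Integrable k := hg.congr' hkm (Filter.Eventually.of_forall fun x => (hkn x).symm)
  have hk2 : MemLp k 2 := hg2.congr_norm hkm (Filter.Eventually.of_forall fun x => (hkn x).symm)
  have hkF : ∀ η, 𝓕 k η = (starRingEnd ℂ) (𝓕 g (ξ - η)) := by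
    intro η
    rw [fourier_eq_integral_wave, fourier_eq_integral_wave, ← integral_conj]
    congr 1; ext x
    simp only [hk, map_mul, wave_conj]
    rw [← mul_assoc, ← wave_add]
    congr 2; abel
  have h := Lp.inner_fourier_eq (hk2.toLp k) (hf2.toLp f)
  rw [L2.inner_def, L2.inner_def] at h
  have h1 : ∫ x, inner ℂ ((hk2.toLp k) x) ((hf2.toLp f) x) = 𝓕 (fun x => f x * g x) ξ := by
    rw [fourier_eq_integral_wave]
    refine integral_congr_ae ?_
    filter_upwards [hk2.coeFn_toLp, hf2.coeFn_toLp] with x e1 e2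
    rw [e1, e2]
    simp [hk]
    ring
  rw [← h1, ← h]
  refine integral_congr_ae ?_
  filter_upwards [coeFn_fourier_toLp hk1 hk2, coeFn_fourier_toLp hf hf2] with η e1 e2
  rw [e1, e2, hkF]
  simp

/-- Square integrability on compact sets. -/
def LocL2 (F : E3 → ℝ) : Prop := ∀ K : Set E3, IsCompact K → MemLp F 2 (volume.restrict K)

lemma LocL2.memLp_mul_test {F : E3 → ℝ} (hF : LocL2 F) (φ : testSpace) :
    MemLp (fun x => (F x : ℂ) * (φ : E3 → ℂ) x) 2 := by
  obtain ⟨C, hC⟩ := (continuous φ).bounded_above_of_compact_support φ.2.2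
  have hK : IsCompact (tsupport (φ : E3 → ℂ)) := φ.2.2
  have h1 : MemLp ((tsupport (φ : E3 → ℂ)).indicator fun x => (F x : ℂ)) 2 := by
    rw [memLp_indicator_iff_restrict hK.measurableSet]
    exact (hF _ hK).ofReal
  have e : (fun x => (F x : ℂ) * (φ : E3 → ℂ) x) = fun x =>
      (tsupport (φ : E3 → ℂ)).indicator (fun x => (F x : ℂ)) x * (φ : E3 → ℂ) x := by
    ext x
    by_cases hx : x ∈ tsupport (φ : E3 → ℂ)
    · simp [hx]
    · simp [image_eq_zero_of_notMem_tsupport hx]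
  rw [e]
  refine h1.of_le_mul (c := C) (h1.1.mul (continuous φ).aestronglyMeasurable)
    (Filter.Eventually.of_forall fun x => ?_)
  rw [norm_mul, mul_comm]
  gcongr
  exact hC x

lemma exists_test_eq_one_on_tsupport (φ : testSpace) :
    ∃ χ : testSpace, ∀ x, (φ : E3 → ℂ) x * (χ : E3 → ℂ) x = (φ : E3 → ℂ) x := by
  obtain ⟨R, hR⟩ := φ.2.2.isBounded.subset_closedBall (0 : E3)
  let b : ContDiffBump (0 : E3) := ⟨max R 1, max R 1 + 1, by positivity, by linarith⟩
  refine ⟨⟨fun x => (b x : ℂ), Complex.ofRealCLM.contDiff.comp b.contDiff,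
    b.hasCompactSupport.comp_left (g := Complex.ofReal) (by simp)⟩, fun x => ?_⟩
  by_cases hx : x ∈ tsupport (φ : E3 → ℂ)
  · have h1 : b x = 1 := b.one_of_mem_closedBall
      (Metric.closedBall_subset_closedBall (le_max_left R 1) (hR hx))
    simp [h1]
  · simp [image_eq_zero_of_notMem_tsupport hx]

/-- Products of functions of local Sobolev regularity `s ≥ 1` lose at most `3 / 4` derivatives. -/
lemma LocSobolev.mul {F G : E3 → ℝ} (hF : LocallyIntegrable F) (hG : LocallyIntegrable G)
    (hFG : LocallyIntegrable fun x => F x * G x) (hF2 : LocL2 F) (hG2 : LocL2 G) {s : ℝ}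
    (hs : 1 ≤ s) (h1 : LocSobolev s (ofFun F hF)) (h2 : LocSobolev s (ofFun G hG)) :
    LocSobolev (s - 3 / 4) (ofFun (fun x => F x * G x) hFG) := by
  intro φ
  -- Since `φχ = φ`, the localized product splits as `φFG = (φF)(χG)`.
  obtain ⟨χ, hχ⟩ := exists_test_eq_one_on_tsupport φ
  set f : E3 → ℂ := fun x => (F x : ℂ) * (φ : E3 → ℂ) x
  set g : E3 → ℂ := fun x => (G x : ℂ) * (χ : E3 → ℂ) x
  have hf1 : Integrable f := integrable_ofReal_mul_test hF φ
  have hg1 : Integrable g := integrable_ofReal_mul_test hG χ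
  have hfw : WeightedL2 s (𝓕 f) := by simpa only [ofFun_modulate] using h1 φ
  have hgw : WeightedL2 s (𝓕 g) := by simpa only [ofFun_modulate] using h2 χ
  have hprod : (fun x => ((F x * G x : ℝ) : ℂ) * (φ : E3 → ℂ) x) = fun x => f x * g x := by
    ext x
    simp only [f, g]
    push_cast
    linear_combination (- (F x : ℂ) * G x) * hχ x
  simp only [ofFun_modulate, hprod]
  have hint : Integrable fun x => f x * g x := by
    rw [← hprod]
    exact integrable_ofReal_mul_test hFG φ
  rw [weightedL2_iff] at hfw hgw ⊢
  -- The kernel condition is `2s + 3/2 > 3`, true for `s ≥ 1`. A loss of `1/2` would be the excluded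
  -- endpoint at `s = 1`; a loss below `1` is what the bootstrap needs.
  obtain ⟨C, hC, hker⟩ := exists_kernel_bound (α := s) (τ := s - 3 / 4) (by linarith)
    (by linarith) (by linarith)
  refine ⟨(continuous_fourier hint).aestronglyMeasurable, lt_of_le_of_lt ?_
    (lintegral_convolution_sq_lt_top hfw.1.enorm hgw.1.enorm hfw.2 hgw.2 hC hker)⟩
  refine lintegral_mono fun ξ => ?_
  rw [fourier_mul_eq_convolution hf1 (hF2.memLp_mul_test φ) hg1 (hG2.memLp_mul_test χ)]
  gcongr
  refine (enorm_integral_le_lintegral_enorm _).trans (le_of_eq ?_)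
  simp only [enorm_mul]

/-! ### Homogeneous Sobolev spaces -/

lemma exists_schwartz_bound (f : 𝓢(E3, ℂ)) (N : ℝ) :
    ∃ C : ℝ, 0 ≤ C ∧ ∀ ζ, ‖f ζ‖ ≤ C * bracket (-N) ζ := by
  have h : (fun ξ : E3 => (bracket N ξ : ℂ)).HasTemperateGrowth := by
    unfold bracket
    fun_prop
  set k := SchwartzMap.smulLeftCLM ℂ (fun ξ : E3 => (bracket N ξ : ℂ)) f with hk
  refine ⟨SchwartzMap.seminorm ℝ 0 0 k, by positivity, fun ζ => ?_⟩
  have h1 := SchwartzMap.norm_le_seminorm ℝ k ζ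
  rw [hk, SchwartzMap.smulLeftCLM_apply_apply h, norm_smul, Complex.norm_real, Real.norm_eq_abs,
    abs_of_pos (bracket_pos _ _), ← hk] at h1
  calc ‖f ζ‖ = (bracket (-N) ζ * bracket N ζ) * ‖f ζ‖ := by rw [bracket_neg_mul, one_mul]
    _ = bracket (-N) ζ * (bracket N ζ * ‖f ζ‖) := by ring
    _ ≤ bracket (-N) ζ * SchwartzMap.seminorm ℝ 0 0 k := by
        gcongr
        exact (bracket_pos _ _).le
    _ = _ := mul_comm _ _

lemma fourierInv_modulate (φ : testSpace) (ξ η : E3) :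
    𝓕⁻ (modulate ξ φ : E3 → ℂ) η = 𝓕 (φ : E3 → ℂ) (ξ - η) := by
  rw [Real.fourierInv_eq_fourier_neg, fourier_eq_integral_wave, fourier_eq_integral_wave]
  congr 1; ext x
  rw [modulate_apply, ← mul_assoc, ← wave_add]
  congr 2; abel

/-- The transform of `φF` is `h * 𝓕 φ`: the definition of `𝓕 T` is applied to the inverse transform
of `modulate ξ φ`. -/
lemma ofFun_modulate_eq_convolution {F : E3 → ℝ} (hF : LocallyIntegrable F) {T : 𝓢'(E3, ℂ)}
    (hT : Represents F T) {h : E3 → ℂ} (hh : ∀ φ : 𝓢(E3, ℂ), (𝓕 T) φ = ∫ ξ, h ξ * φ ξ)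
    (φ : testSpace) (ξ : E3) :
    ofFun F hF (modulate ξ φ) = ∫ η, h η * 𝓕 (φ : E3 → ℂ) (ξ - η) := by
  have h1 := hT.2 (toSchwartz (modulate ξ φ)) (modulate ξ φ).2.2
  have h2 := hh (𝓕⁻ (toSchwartz (modulate ξ φ)))
  rw [TemperedDistribution.fourier_apply, FourierTransform.fourier_fourierInv_eq, h1] at h2
  rw [ofFun_apply]
  refine h2.trans ?_
  congr 1; ext η
  rw [SchwartzMap.fourierInv_coe, ← fourierInv_modulate]
  rfl

/-- For `η` in the unit ball, Peetre's inequality bounds `bracket (-(s + 2)) (ξ - η)` by a multiple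
of its value at `ξ`. The weighted integral is therefore `O(bracket (-2) ξ)`, which is square
integrable. -/
lemma lintegral_low_frequency_lt_top {A B : E3 → ℝ≥0∞}
    {s : ℝ} (hs : 0 ≤ s) (hA : ∫⁻ η in Metric.closedBall 0 1, A η < ⊤) {C : ℝ} (hC0 : 0 ≤ C)
    (hB : ∀ ζ, B ζ ≤ ENNReal.ofReal (C * bracket (-(s + 2)) ζ)) :
    ∫⁻ ξ, (eBracket s ξ * ∫⁻ η in Metric.closedBall 0 1, A η * B (ξ - η)) ^ 2 < ⊤ := by
  set c : ℝ := C * (2 ^ (s + 2) * 2 ^ ((s + 2) / 2)) with hc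
  set I := ∫⁻ η in Metric.closedBall (0 : E3) 1, A η with hI
  have hb : ∀ ξ η : E3, η ∈ Metric.closedBall (0 : E3) 1 →
      B (ξ - η) ≤ ENNReal.ofReal c * eBracket (-(s + 2)) ξ := by
    intro ξ η hη
    rw [mem_closedBall_zero_iff] at hη
    refine (hB _).trans ?_
    rw [eBracket, ← ENNReal.ofReal_mul (by positivity)]
    refine ENNReal.ofReal_le_ofReal ?_
    have h1 := bracket_le_mul (s := s + 2) (by linarith) ξ η
    have h2 : bracket (s + 2) η ≤ 2 ^ ((s + 2) / 2) := by
      unfold bracket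
      refine Real.rpow_le_rpow (by positivity) ?_ (by positivity)
      nlinarith [norm_nonneg η]
    rw [hc, mul_assoc]
    refine mul_le_mul_of_nonneg_left ?_ hC0
    have e1 := bracket_neg_mul (s + 2) (ξ - η)
    have e2 := bracket_neg_mul (s + 2) ξ
    have p1 := bracket_pos (-(s + 2)) ξ
    have p2 := bracket_pos (-(s + 2)) (ξ - η)
    calc bracket (-(s + 2)) (ξ - η)
        = (bracket (-(s + 2)) ξ * bracket (s + 2) ξ) * bracket (-(s + 2)) (ξ - η) := by
          rw [e2, one_mul]
      _ ≤ (bracket (-(s + 2)) ξ * (2 ^ (s + 2) * (bracket (s + 2) η * bracket (s + 2) (ξ - η)))) *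
          bracket (-(s + 2)) (ξ - η) := by gcongr
      _ = (2 ^ (s + 2) * bracket (s + 2) η) * bracket (-(s + 2)) ξ *
          (bracket (-(s + 2)) (ξ - η) * bracket (s + 2) (ξ - η)) := by ring
      _ = (2 ^ (s + 2) * bracket (s + 2) η) * bracket (-(s + 2)) ξ := by rw [e1, mul_one]
      _ ≤ _ := by gcongr
  have hbound : ∀ ξ, (eBracket s ξ * ∫⁻ η in Metric.closedBall 0 1, A η * B (ξ - η)) ^ 2 ≤
      (I * ENNReal.ofReal c) ^ 2 * eBracket (-4) ξ := by
    intro ξ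
    have h1 : ∫⁻ η in Metric.closedBall 0 1, A η * B (ξ - η) ≤
        I * (ENNReal.ofReal c * eBracket (-(s + 2)) ξ) := by
      rw [hI, ← lintegral_mul_const' (ENNReal.ofReal c * eBracket (-(s + 2)) ξ) _ (ENNReal.mul_ne_top ENNReal.ofReal_ne_top
        ENNReal.ofReal_ne_top)]
      refine setLIntegral_mono' measurableSet_closedBall fun η hη => ?_
      gcongr
      exact hb ξ η hη
    calc _ ≤ (eBracket s ξ * (I * (ENNReal.ofReal c * eBracket (-(s + 2)) ξ))) ^ 2 := by gcongr
      _ = (I * ENNReal.ofReal c) ^ 2 * (eBracket s ξ * eBracket (-(s + 2)) ξ) ^ 2 := by ring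
      _ = _ := by
        rw [← eBracket_add, eBracket_sq]
        ring_nf
  refine (lintegral_mono hbound).trans_lt ?_
  rw [lintegral_const_mul _ (measurable_eBracket _)]
  exact ENNReal.mul_lt_top (ENNReal.pow_lt_top (ENNReal.mul_lt_top hA ENNReal.ofReal_lt_top))
    (lintegral_eBracket_lt_top (r := 4) (by norm_num))

/-- `h` is split at the unit sphere: inside, only its local integrability is used; outside, `‖ξ‖ ^
s` is comparable to `bracket s`. Both pieces are convolved with the Schwartz function `𝓕 φ`. -/
lemma LocSobolev.of_inHomSobolev {F : E3 → ℝ} (hF : LocallyIntegrable F) {s : ℝ} (hs : 0 ≤ s)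
    (h : InHomSobolev s F) : LocSobolev s (ofFun F hF) := by
  obtain ⟨T, hT, h, hloc, hh, hL2⟩ := h
  intro φ
  set Ψ := 𝓕 (toSchwartz φ) with hΨ
  have hconv : ∀ ξ, ofFun F hF (modulate ξ φ) = ∫ η, h η * Ψ (ξ - η) := fun ξ =>
    ofFun_modulate_eq_convolution hF hT hh φ ξ
  rw [weightedL2_iff]
  constructor
  · simp only [ofFun_modulate]
    exact (continuous_fourier (integrable_ofReal_mul_test hF φ)).aestronglyMeasurable
  set K := Metric.closedBall (0 : E3) 1 with hK
  have hKm : MeasurableSet K := measurableSet_closedBall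
  have hΨw := weightedL2_iff.1 (weightedL2_schwartz (s + 2) Ψ)
  obtain ⟨C0, hC0, hC⟩ := exists_schwartz_bound Ψ (s + 2)
  have low : ∫⁻ ξ, (eBracket s ξ * ∫⁻ η in K, ‖h η‖ₑ * ‖Ψ (ξ - η)‖ₑ) ^ 2 < ⊤ := by
    refine lintegral_low_frequency_lt_top (A := fun η => ‖h η‖ₑ) (B := fun ζ => ‖Ψ ζ‖ₑ) hs ?_ hC0
      fun ζ => ?_
    · exact (hloc.integrableOn_isCompact (isCompact_closedBall 0 1)).2
    · rw [← ofReal_norm]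
      exact ENNReal.ofReal_le_ofReal (hC ζ)
  have high : ∫⁻ ξ, (eBracket s ξ * ∫⁻ η, Kᶜ.indicator (fun η => ‖h η‖ₑ) η * ‖Ψ (ξ - η)‖ₑ) ^ 2
      < ⊤ := by
    obtain ⟨C, hC, hker⟩ := exists_kernel_bound_schwartz hs
    refine lintegral_convolution_sq_lt_top (B := fun ζ => ‖Ψ ζ‖ₑ)
      (hloc.aestronglyMeasurable.enorm.indicator hKm.compl)
      hΨw.1.enorm ?_ hΨw.2 hC hker
    have hfin : ∫⁻ ξ, (‖((‖ξ‖ ^ s : ℝ) : ℂ) * h ξ‖ₑ) ^ 2 < ⊤ := by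
      have := (eLpNorm_lt_top_iff_lintegral_rpow_enorm_lt_top (by norm_num) (by norm_num)).1 hL2.2
      simpa using this
    refine lt_of_le_of_lt (lintegral_mono (g := fun ξ => ENNReal.ofReal (2 ^ (s / 2)) ^ 2 *
      (‖((‖ξ‖ ^ s : ℝ) : ℂ) * h ξ‖ₑ) ^ 2) fun η => ?_) ?_
    · by_cases hη : η ∈ K
      · simp [hη]
      · have h1 : 1 ≤ ‖η‖ := by
          rw [hK, mem_closedBall_zero_iff, not_le] at hη
          exact hη.le
        -- Off the unit ball, `1 + ‖η‖ ^ 2 ≤ 2 * ‖η‖ ^ 2`.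
        have h2 : bracket s η ≤ 2 ^ (s / 2) * ‖η‖ ^ s := by
          have : ‖η‖ ^ s = (‖η‖ ^ 2) ^ (s / 2) := by
            rw [← Real.rpow_natCast, ← Real.rpow_mul (norm_nonneg _)]
            congr 1
            push_cast
            ring
          unfold bracket
          rw [this, ← Real.mul_rpow (by norm_num) (by positivity)]
          refine Real.rpow_le_rpow (by positivity) ?_ (by positivity)
          nlinarith
        have hmem : η ∈ Kᶜ := hη
        simp only [Set.indicator_of_mem hmem]
        rw [← mul_pow, enorm_mul, ← mul_assoc]
        gcongr
        rw [← ofReal_norm (((‖η‖ ^ s : ℝ) : ℂ)), Complex.norm_real,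
          Real.norm_of_nonneg (by positivity), ← ENNReal.ofReal_mul (by positivity)]
        exact ENNReal.ofReal_le_ofReal h2
    · rw [lintegral_const_mul' _ _ (by simp)]
      exact ENNReal.mul_lt_top (by simp) hfin
  have hsum : ∀ ξ, (eBracket s ξ * ‖ofFun F hF (modulate ξ φ)‖ₑ) ^ 2 ≤
      2 * ((eBracket s ξ * ∫⁻ η in K, ‖h η‖ₑ * ‖Ψ (ξ - η)‖ₑ) ^ 2 +
      (eBracket s ξ * ∫⁻ η, Kᶜ.indicator (fun η => ‖h η‖ₑ) η * ‖Ψ (ξ - η)‖ₑ) ^ 2) := by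
    intro ξ
    have h1 : ‖ofFun F hF (modulate ξ φ)‖ₑ ≤ (∫⁻ η in K, ‖h η‖ₑ * ‖Ψ (ξ - η)‖ₑ) +
        ∫⁻ η, Kᶜ.indicator (fun η => ‖h η‖ₑ) η * ‖Ψ (ξ - η)‖ₑ := by
      rw [hconv]
      refine (enorm_integral_le_lintegral_enorm _).trans (le_of_eq ?_)
      rw [← lintegral_add_compl _ hKm]
      congr 1
      · simp only [enorm_mul]
      · rw [← lintegral_indicator hKm.compl]
        congr 1; ext η
        by_cases hη : η ∈ K <;> simp [hη]
    have h2 := ENNReal.rpow_add_le_mul_rpow_add_rpow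
      (eBracket s ξ * ∫⁻ η in K, ‖h η‖ₑ * ‖Ψ (ξ - η)‖ₑ)
      (eBracket s ξ * ∫⁻ η, Kᶜ.indicator (fun η => ‖h η‖ₑ) η * ‖Ψ (ξ - η)‖ₑ)
      (p := 2) (by norm_num)
    norm_num at h2
    refine le_trans ?_ h2
    rw [← mul_add]
    gcongr
  refine (lintegral_mono hsum).trans_lt ?_
  rw [lintegral_const_mul' _ _ (by norm_num)]
  refine ENNReal.mul_lt_top (by norm_num) ?_
  have hmeas : AEMeasurable fun ξ =>
      (eBracket s ξ * ∫⁻ η in K, ‖h η‖ₑ * ‖Ψ (ξ - η)‖ₑ) ^ 2 := by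
    refine ((measurable_eBracket s).aemeasurable.mul ?_).pow_const 2
    refine AEMeasurable.lintegral_prod_right' (f := fun z : E3 × E3 => ‖h z.2‖ₑ * ‖Ψ (z.1 - z.2)‖ₑ) ?_
    refine AEMeasurable.mul (f := fun z : E3 × E3 => ‖h z.2‖ₑ)
      (g := fun z : E3 × E3 => ‖Ψ (z.1 - z.2)‖ₑ) ?_ ?_
    · exact hloc.aestronglyMeasurable.restrict.enorm.comp_quasiMeasurePreserving
        Measure.quasiMeasurePreserving_snd
    · exact (Ψ.continuous.comp (continuous_fst.sub continuous_snd)).enorm.aemeasurable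
  rw [lintegral_add_left' hmeas]
  exact ENNReal.add_lt_top.2 ⟨low, high⟩

/-- Functions in the inhomogeneous Sobolev space of order one lie in the homogeneous one. -/
lemma memHomSobolev_one_of_memSobolev {T : 𝓢'(E3, ℂ)}
    (h : TemperedDistribution.MemSobolev 1 2 T) : MemHomSobolev 1 T := by
  obtain ⟨g, hg⟩ := TemperedDistribution.memSobolev_iff_exists_smulLeftCLM_fourier.1 h
  have ht : ∀ s : ℝ, (fun ξ : E3 => (bracket s ξ : ℂ)).HasTemperateGrowth := fun s => by
    unfold bracket
    fun_prop
  have hb : ∀ s : ℝ, Continuous fun ξ : E3 => (bracket s ξ : ℂ) := fun s =>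
    Complex.continuous_ofReal.comp (continuous_bracket s)
  have hw : WeightedL2 0 g := by
    have := Lp.memLp g
    simpa [WeightedL2, bracket_zero] using this
  have hw1 : WeightedL2 1 (fun ξ => (bracket (-1) ξ : ℂ) * g ξ) := by
    have := hw.mul_symbol (hb (-1)) (k := -1) (C := 1) (fun ξ => by
      simp [abs_of_pos (bracket_pos _ _)])
    simpa using this
  refine ⟨fun ξ => (bracket (-1) ξ : ℂ) * g ξ, ?_, fun φ => ?_, ?_⟩
  · have : MemLp (fun ξ => (bracket (-1) ξ : ℂ) * g ξ) 2 := by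
      simpa [WeightedL2, bracket_zero] using hw1.mono (t := 0) (by norm_num)
    exact this.locallyIntegrable (by norm_num)
  · have h1 := congrArg (fun S : 𝓢'(E3, ℂ) =>
      -- Testing with `bracket (-1) * φ` undoes the factor `bracket 1` in front of `𝓕 T`.
      S (SchwartzMap.smulLeftCLM ℂ (fun ξ : E3 => (bracket (-1) ξ : ℂ)) φ)) hg
    have h2 : SchwartzMap.smulLeftCLM ℂ (fun ξ : E3 => (bracket 1 ξ : ℂ))
        (SchwartzMap.smulLeftCLM ℂ (fun ξ : E3 => (bracket (-1) ξ : ℂ)) φ) = φ := by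
      ext ξ
      rw [SchwartzMap.smulLeftCLM_apply_apply (ht 1), SchwartzMap.smulLeftCLM_apply_apply (ht (-1)),
        smul_smul, ← Complex.ofReal_mul, mul_comm, bracket_neg_mul]
      simp
    have h3 : (𝓕 T) (SchwartzMap.smulLeftCLM ℂ (fun ξ : E3 => (bracket 1 ξ : ℂ))
        (SchwartzMap.smulLeftCLM ℂ (fun ξ : E3 => (bracket (-1) ξ : ℂ)) φ)) = _ := h1
    rw [h2, Lp.toTemperedDistribution_apply] at h3
    rw [h3]
    congr 1; ext ξ
    rw [SchwartzMap.smulLeftCLM_apply_apply (ht (-1))]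
    simp only [smul_eq_mul]
    ring
  · have := hw1.mul_symbol (m := fun ξ => ((‖ξ‖ : ℝ) : ℂ)) (by fun_prop) (k := 1) (C := 1)
      (fun ξ => by simpa using norm_le_bracket_one ξ)
    simpa [WeightedL2, bracket_zero] using this

end

/-! ### The bootstrap for the micropolar system -/

/-- The Levi-Civita symbol. -/
noncomputable def leviCivita (i j k : Fin 3) : ℝ :=
  -- A Vandermonde product: zero on repeated indices, `±2` on permutations of `0, 1, 2`.
  ((j : ℝ) - i) * ((k : ℝ) - i) * ((k : ℝ) - j) / 2

/-- The micropolar fluid system for distributions, with `UU` and `WU` in the place of the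
products `u ⊗ u` and `w ⊗ u`. -/
structure MicropolarSystem (κ : ℝ) (U W F G : Fin 3 → Distr) (P : Distr)
    (UU WU : Fin 3 → Fin 3 → Distr) : Prop where
  div_u : ∑ a, U a ∘ₗ deriv a = 0
  div_f : ∑ a, F a ∘ₗ deriv a = 0
  -- Composition with `deriv` is minus the distributional derivative. In the curl this sign is
  -- offset by the index order in `leviCivita b j a`.
  velocity : ∀ a, U a ∘ₗ testLaplacian + ∑ j, UU a j ∘ₗ deriv j + P ∘ₗ deriv a
    + (1 / 2 : ℂ) • ∑ b, ∑ j, (leviCivita b j a : ℂ) • (W b ∘ₗ deriv j) + F a = 0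
  microrotation : ∀ a, W a ∘ₗ testLaplacian + (∑ b, W b ∘ₗ deriv b) ∘ₗ deriv a - (κ : ℂ) • W a
    + ∑ j, WU a j ∘ₗ deriv j
    + (1 / 2 : ℂ) • ∑ b, ∑ j, (leviCivita b j a : ℂ) • (U b ∘ₗ deriv j) + G a = 0

namespace MicropolarSystem

variable {κ : ℝ} {U W F G : Fin 3 → Distr} {P : Distr} {UU WU : Fin 3 → Fin 3 → Distr}

lemma laplacian_deriv (a : Fin 3) (φ : testSpace) :
    testLaplacian (deriv a φ) = deriv a (testLaplacian φ) := by
  simp [testLaplacian, deriv_comm _ a]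

lemma curl_locSobolev {V : Fin 3 → Distr} {s : ℝ} (hV : ∀ b, LocSobolev s (V b)) (a : Fin 3) :
    LocSobolev (s - 1) ((1 / 2 : ℂ) • ∑ b, ∑ j, (leviCivita b j a : ℂ) • (V b ∘ₗ deriv j)) :=
  (LocSobolev.sum _ fun b _ => LocSobolev.sum _ fun j _ => ((hV b).comp_deriv j).smul _).smul _

lemma velocity_regularity (h : MicropolarSystem κ U W F G P UU WU) {s : ℝ}
    (hF : ∀ a s, LocSobolev s (F a)) (hU : ∀ a, LocSobolev s (U a)) (hW : ∀ a, LocSobolev s (W a))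
    (hP : LocSobolev (s - 3 / 4) P) (hUU : ∀ a j, LocSobolev (s - 3 / 4) (UU a j)) (a : Fin 3) :
    LocSobolev (s + 1 / 4) (U a) := by
  refine LocSobolev.of_laplacian ((hU a).mono (by linarith)) ?_
  have e : U a ∘ₗ testLaplacian = -(∑ j, UU a j ∘ₗ deriv j + P ∘ₗ deriv a
      + (1 / 2 : ℂ) • ∑ b, ∑ j, (leviCivita b j a : ℂ) • (W b ∘ₗ deriv j) + F a) := by
    rw [eq_neg_iff_add_eq_zero, ← h.velocity a]
    abel
  rw [e]
  refine LocSobolev.neg (((LocSobolev.add ?_ ?_).add ?_).add (hF a _))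
  · exact LocSobolev.sum _ fun j _ => ((hUU a j).comp_deriv j).mono (by linarith)
  · exact (hP.comp_deriv a).mono (by linarith)
  · exact (curl_locSobolev hW a).mono (by linarith)

/-- With `R` the lower order terms, `Δw + ∇d = R` for `d = div w`. Its divergence is `2Δd = div R`,
so `d` improves first, and `∇d` can then be moved to the right-hand side. -/
lemma microrotation_regularity (h : MicropolarSystem κ U W F G P UU WU) {s : ℝ}
    (hG : ∀ a s, LocSobolev s (G a)) (hU : ∀ a, LocSobolev s (U a)) (hW : ∀ a, LocSobolev s (W a))
    (hWU : ∀ a j, LocSobolev (s - 3 / 4) (WU a j)) (a : Fin 3) :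
    LocSobolev (s + 1 / 4) (W a) := by
  set d : Distr := ∑ b, W b ∘ₗ deriv b with hd
  set R : Fin 3 → Distr := fun a => -(-((κ : ℂ) • W a) + ∑ j, WU a j ∘ₗ deriv j
      + (1 / 2 : ℂ) • ∑ b, ∑ j, (leviCivita b j a : ℂ) • (U b ∘ₗ deriv j) + G a) with hR
  have e : ∀ a, W a ∘ₗ testLaplacian + d ∘ₗ deriv a = R a := by
    intro a
    rw [hR, eq_neg_iff_add_eq_zero, ← h.microrotation a]
    abel
  have hRs : ∀ a, LocSobolev (s + 1 / 4 - 2) (R a) := by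
    intro a
    refine LocSobolev.neg (((LocSobolev.add ?_ ?_).add ?_).add (hG a _))
    · exact (((hW a).smul _).neg).mono (by linarith)
    · exact LocSobolev.sum _ fun j _ => ((hWU a j).comp_deriv j).mono (by linarith)
    · exact (curl_locSobolev hU a).mono (by linarith)
  have hd0 : LocSobolev (s - 1) d := LocSobolev.sum _ fun b _ => (hW b).comp_deriv b
  have hdΔ : d ∘ₗ testLaplacian = (1 / 2 : ℂ) • ∑ a, R a ∘ₗ deriv a := by
    ext φ
    simp only [← e, hd, LinearMap.comp_apply, LinearMap.add_apply, LinearMap.smul_apply,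
      Fin.sum_univ_three, laplacian_deriv]
    simp only [testLaplacian, Fin.sum_univ_three, LinearMap.comp_apply, LinearMap.add_apply,
      map_add, smul_eq_mul]
    rw [deriv_comm 1 0, deriv_comm 2 0, deriv_comm 2 1]
    simp only [deriv_comm 1 0, deriv_comm 2 0, deriv_comm 2 1]
    ring
  have hd1 : LocSobolev (s + 1 / 4 - 1) d := by
    refine LocSobolev.of_laplacian (hd0.mono (by linarith)) ?_
    rw [hdΔ]
    exact (LocSobolev.sum _ fun a _ => ((hRs a).comp_deriv a).mono (by linarith)).smul _
  refine LocSobolev.of_laplacian ((hW a).mono (by linarith)) ?_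
  rw [eq_sub_of_add_eq (e a)]
  exact (hRs a).sub ((hd1.comp_deriv a).mono (by linarith))

/-- The component equations are tested with `∂ₐφ` and summed: `div u = 0` removes the Laplacian,
`div f = 0` the force, and antisymmetry the curl. -/
lemma pressure_laplacian (h : MicropolarSystem κ U W F G P UU WU) :
    P ∘ₗ testLaplacian = -∑ a, ∑ j, (UU a j ∘ₗ deriv j) ∘ₗ deriv a := by
  have hv : ∀ a φ, U a (testLaplacian φ) + ∑ j, UU a j (deriv j φ) + P (deriv a φ)
      + (1 / 2 : ℂ) * ∑ b, ∑ j, (leviCivita b j a : ℂ) * W b (deriv j φ) + F a φ = 0 := by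
    intro a φ
    simpa using LinearMap.congr_fun (h.velocity a) φ
  ext φ
  have hu : ∑ a, U a (deriv a (testLaplacian φ)) = 0 := by
    simpa using LinearMap.congr_fun h.div_u (testLaplacian φ)
  have hf : ∑ a, F a (deriv a φ) = 0 := by
    simpa using LinearMap.congr_fun h.div_f φ
  have h0 := hv 0 (deriv 0 φ)
  have h1 := hv 1 (deriv 1 φ)
  have h2 := hv 2 (deriv 2 φ)
  simp only [LinearMap.comp_apply, LinearMap.neg_apply, Fin.sum_univ_three,
    laplacian_deriv] at h0 h1 h2 hu hf ⊢
  simp only [testLaplacian, Fin.sum_univ_three, LinearMap.comp_apply, LinearMap.add_apply,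
    map_add] at h0 h1 h2 hu hf ⊢
  simp only [deriv_comm 1 0, deriv_comm 2 0, deriv_comm 2 1] at h0 h1 h2 hu hf ⊢
  simp only [leviCivita] at h0 h1 h2
  norm_num at h0 h1 h2
  linear_combination h0 + h1 + h2 - hu - hf

lemma pressure_regularity (h : MicropolarSystem κ U W F G P UU WU) {t : ℝ}
    (hP : LocSobolev (t - 1) P) (hUU : ∀ a j, LocSobolev t (UU a j)) : LocSobolev t P := by
  refine LocSobolev.of_laplacian hP ?_
  rw [h.pressure_laplacian]
  exact (LocSobolev.sum _ fun a _ => LocSobolev.sum _ fun j _ =>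
    (((hUU a j).comp_deriv j).comp_deriv a).mono (by linarith)).neg

theorem locSobolev_all (h : MicropolarSystem κ U W F G P UU WU)
    (hF : ∀ a s, LocSobolev s (F a)) (hG : ∀ a s, LocSobolev s (G a))
    (hUU : ∀ s, 1 ≤ s → (∀ a, LocSobolev s (U a)) → ∀ a j, LocSobolev (s - 3 / 4) (UU a j))
    (hWU : ∀ s, 1 ≤ s → (∀ a, LocSobolev s (U a)) → (∀ a, LocSobolev s (W a)) →
      ∀ a j, LocSobolev (s - 3 / 4) (WU a j))
    (hU : ∀ a, LocSobolev 1 (U a)) (hW : ∀ a, LocSobolev 1 (W a)) (hP : LocSobolev (1 / 4) P)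
    (s : ℝ) : (∀ a, LocSobolev s (U a)) ∧ (∀ a, LocSobolev s (W a)) ∧ LocSobolev s P := by
  -- The pressure stays `3/4` behind the velocity, like the products.
  have key : ∀ n : ℕ, (∀ a, LocSobolev (1 + n / 4) (U a)) ∧ (∀ a, LocSobolev (1 + n / 4) (W a)) ∧
      LocSobolev (1 + n / 4 - 3 / 4) P := by
    intro n
    induction n with
    | zero =>
      refine ⟨fun a => ?_, fun a => ?_, ?_⟩
      · simpa using hU a
      · simpa using hW a
      · exact hP.mono (by norm_num)
    | succ n ih =>
      obtain ⟨hU', hW', hP'⟩ := ih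
      have hs : (1 : ℝ) ≤ 1 + n / 4 := by
        have : (0 : ℝ) ≤ n / 4 := by positivity
        linarith
      have e : (1 : ℝ) + (n + 1 : ℕ) / 4 = 1 + n / 4 + 1 / 4 := by push_cast; ring
      have hU1 := h.velocity_regularity hF hU' hW' hP' (hUU _ hs hU')
      have hW1 := h.microrotation_regularity hG hU' hW' (hWU _ hs hU' hW')
      rw [e]
      -- The pressure is updated from products of the already improved velocity.
      exact ⟨hU1, hW1, h.pressure_regularity (hP'.mono (by linarith))
        (hUU _ (by linarith) hU1)⟩
  obtain ⟨n, hn⟩ := exists_nat_ge (4 * (s + 3 / 4))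
  obtain ⟨hU', hW', hP'⟩ := key n
  exact ⟨fun a => (hU' a).mono (by linarith), fun a => (hW' a).mono (by linarith),
    hP'.mono (by linarith)⟩

end MicropolarSystem

/-! ### From the weak formulation to the system for distributions -/

/-- A real valued test function. -/
def realTest (θ : E3 → ℝ) (h1 : ContDiff ℝ ∞ θ) (h2 : HasCompactSupport θ) : testSpace :=
  ⟨fun x => (θ x : ℂ), Complex.ofRealCLM.contDiff.comp h1,
    h2.comp_left (g := Complex.ofReal) (by simp)⟩

/-- The weak formulation has real test fields; complex linearity and `φ = Re φ + i Im φ` give the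
rest. -/
lemma distr_eq_zero_of_realTest {L : Distr}
    (h : ∀ (θ : E3 → ℝ) (h1 : ContDiff ℝ ∞ θ) (h2 : HasCompactSupport θ),
      L (realTest θ h1 h2) = 0) : L = 0 := by
  ext φ
  have hr := h (fun x => ((φ : E3 → ℂ) x).re) (Complex.reCLM.contDiff.comp φ.2.1)
    (φ.2.2.comp_left (g := Complex.re) (by simp))
  have hi := h (fun x => ((φ : E3 → ℂ) x).im) (Complex.imCLM.contDiff.comp φ.2.1)
    (φ.2.2.comp_left (g := Complex.im) (by simp))
  have e : φ = realTest (fun x => ((φ : E3 → ℂ) x).re) (Complex.reCLM.contDiff.comp φ.2.1)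
      (φ.2.2.comp_left (g := Complex.re) (by simp)) +
      Complex.I • realTest (fun x => ((φ : E3 → ℂ) x).im) (Complex.imCLM.contDiff.comp φ.2.1)
      (φ.2.2.comp_left (g := Complex.im) (by simp)) := by
    ext x
    simp only [Submodule.coe_add, Submodule.coe_smul, Pi.add_apply, Pi.smul_apply, realTest,
      smul_eq_mul]
    rw [mul_comm, Complex.re_add_im]
  rw [e, map_add, map_smul, hr, hi]
  simp

lemma contDiff_pderiv3 {θ : E3 → ℝ} (h : ContDiff ℝ ∞ θ) (j : Fin 3) :
    ContDiff ℝ ∞ (pderiv3 j θ) :=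
  (h.fderiv_right (m := ∞) (by simp)).clm_apply contDiff_const

lemma hasCompactSupport_pderiv3 {θ : E3 → ℝ} (h : HasCompactSupport θ) (j : Fin 3) :
    HasCompactSupport (pderiv3 j θ) :=
  h.fderiv_apply ℝ _

lemma deriv_realTest (θ : E3 → ℝ) (h1 : ContDiff ℝ ∞ θ) (h2 : HasCompactSupport θ) (j : Fin 3) :
    deriv j (realTest θ h1 h2) =
      realTest (pderiv3 j θ) (contDiff_pderiv3 h1 j) (hasCompactSupport_pderiv3 h2 j) := by
  ext x
  have hd : HasFDerivAt θ (fderiv ℝ θ x) x := (h1.differentiable (by simp) x).hasFDerivAt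
  have := (Complex.ofRealCLM.hasFDerivAt.comp x hd).fderiv
  rw [deriv_apply]
  change fderiv ℝ (Complex.ofRealCLM ∘ θ) x _ = _
  rw [this]
  rfl

/-- The function `f` is integrable with integral `c`. -/
def HasRealIntegral (f : E3 → ℝ) (c : ℂ) : Prop := Integrable f ∧ ((∫ x, f x : ℝ) : ℂ) = c

namespace HasRealIntegral

variable {f g : E3 → ℝ} {c d : ℂ}

lemma add (hf : HasRealIntegral f c) (hg : HasRealIntegral g d) :
    HasRealIntegral (fun x => f x + g x) (c + d) :=
  ⟨hf.1.add hg.1, by rw [integral_add hf.1 hg.1, ← hf.2, ← hg.2]; push_cast; rfl⟩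

lemma const_mul (hf : HasRealIntegral f c) (r : ℝ) :
    HasRealIntegral (fun x => r * f x) (r * c) :=
  ⟨hf.1.const_mul r, by rw [integral_const_mul, ← hf.2]; push_cast; rfl⟩

lemma sub (hf : HasRealIntegral f c) (hg : HasRealIntegral g d) :
    HasRealIntegral (fun x => f x - g x) (c - d) :=
  ⟨hf.1.sub hg.1, by rw [integral_sub hf.1 hg.1, ← hf.2, ← hg.2]; push_cast; rfl⟩

lemma sum {ι : Type*} (I : Finset ι) {f : ι → E3 → ℝ} {c : ι → ℂ}
    (hf : ∀ i ∈ I, HasRealIntegral (f i) (c i)) :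
    HasRealIntegral (fun x => ∑ i ∈ I, f i x) (∑ i ∈ I, c i) := by
  refine ⟨integrable_finsetSum _ fun i hi => (hf i hi).1, ?_⟩
  rw [integral_finsetSum _ fun i hi => (hf i hi).1, Complex.ofReal_sum]
  exact Finset.sum_congr rfl fun i hi => (hf i hi).2

lemma eq_zero (hf : HasRealIntegral f c) (h : ∫ x, f x = 0) : c = 0 := by
  rw [← hf.2, h, Complex.ofReal_zero]

lemma ofFun {F θ : E3 → ℝ} (hF : LocallyIntegrable F) (h1 : ContDiff ℝ ∞ θ)
    (h2 : HasCompactSupport θ) :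
    HasRealIntegral (fun x => F x * θ x) (ofFun F hF (realTest θ h1 h2)) := by
  constructor
  · have := hF.integrable_smul_left_of_hasCompactSupport h1.continuous h2
    simpa [mul_comm] using this
  · rw [ofFun_apply]
    refine integral_ofReal.symm.trans ?_
    congr 1; ext x
    simp [realTest]

lemma ofFun_deriv {F θ : E3 → ℝ} (hF : LocallyIntegrable F) (h1 : ContDiff ℝ ∞ θ)
    (h2 : HasCompactSupport θ) (j : Fin 3) :
    HasRealIntegral (fun x => F x * pderiv3 j θ x)
      (_root_.ofFun F hF (deriv j (realTest θ h1 h2))) := by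
  rw [deriv_realTest]
  exact ofFun hF _ _

lemma ofFun_deriv_deriv {F θ : E3 → ℝ} (hF : LocallyIntegrable F) (h1 : ContDiff ℝ ∞ θ)
    (h2 : HasCompactSupport θ) (i j : Fin 3) :
    HasRealIntegral (fun x => F x * pderiv3 i (pderiv3 j θ) x)
      (_root_.ofFun F hF (deriv i (deriv j (realTest θ h1 h2)))) := by
  rw [deriv_realTest]
  exact ofFun_deriv hF _ _ i

end HasRealIntegral

/-! ### Differential operators on the test fields `θ e_a` -/

lemma clm_apply_eq_sum (L : E3 →L[ℝ] ℝ) (v : E3) :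
    L v = ∑ j, v j * L (EuclideanSpace.single j 1) := by
  conv_lhs => rw [← (EuclideanSpace.basisFun (Fin 3) ℝ).sum_repr v]
  simp

lemma inner_gradient (θ : E3 → ℝ) (v x : E3) :
    inner ℝ v (∇ θ x) = ∑ j, v j * pderiv3 j θ x := by
  rw [real_inner_comm, gradient, InnerProductSpace.toDual_symm_apply, clm_apply_eq_sum]
  rfl

/-- The vector field `θ e_a`. -/
noncomputable def coordField (a : Fin 3) (θ : E3 → ℝ) (x : E3) : E3 := EuclideanSpace.single a (θ x)

/-- The embedding of the `a`-th coordinate axis. -/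
noncomputable def coordEmbedding (a : Fin 3) : ℝ →L[ℝ] E3 :=
  ContinuousLinearMap.toSpanSingleton ℝ (EuclideanSpace.single a 1)

lemma coordField_eq (a : Fin 3) (θ : E3 → ℝ) : coordField a θ = coordEmbedding a ∘ θ := by
  ext x i
  simp [coordField, coordEmbedding]

lemma coordField_apply (a b : Fin 3) (θ : E3 → ℝ) (x : E3) :
    coordField a θ x b = if b = a then θ x else 0 := by
  simp [coordField]

lemma inner_coordEmbedding (v : E3) (a : Fin 3) (r : ℝ) :
    inner ℝ v (coordEmbedding a r) = v a * r := by
  simp [coordEmbedding, inner_smul_right, EuclideanSpace.inner_single_right, mul_comm]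

lemma contDiff_coordField {θ : E3 → ℝ} (h : ContDiff ℝ ∞ θ) (a : Fin 3) :
    ContDiff ℝ ∞ (coordField a θ) := by
  rw [coordField_eq]
  exact (coordEmbedding a).contDiff.comp h

lemma hasCompactSupport_coordField {θ : E3 → ℝ} (h : HasCompactSupport θ) (a : Fin 3) :
    HasCompactSupport (coordField a θ) := by
  rw [coordField_eq]
  exact h.comp_left (map_zero _)

lemma laplacian_eq_sum_pderiv3 {θ : E3 → ℝ} (h : ContDiff ℝ ∞ θ) (x : E3) :
    Δ θ x = ∑ j, pderiv3 j (pderiv3 j θ) x := by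
  rw [InnerProductSpace.laplacian_eq_iteratedFDeriv_orthonormalBasis θ
    (EuclideanSpace.basisFun (Fin 3) ℝ)]
  refine Finset.sum_congr rfl fun j _ => ?_
  have hd : DifferentiableAt ℝ (fderiv ℝ θ) x :=
    ((h.fderiv_right (m := 1) (by norm_cast)).differentiable (by simp)) x
  have : pderiv3 j θ = fun y => fderiv ℝ θ y (EuclideanSpace.single j 1) := rfl
  rw [iteratedFDeriv_two_apply, pderiv3, this, fderiv_clm_apply hd (differentiableAt_const _)]
  simp

lemma inner_laplacian_coordField {θ : E3 → ℝ} (h : ContDiff ℝ ∞ θ) (a : Fin 3) (v x : E3) :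
    inner ℝ v (Δ (coordField a θ) x) = ∑ j, v a * pderiv3 j (pderiv3 j θ) x := by
  rw [coordField_eq, ContDiffAt.laplacian_CLM_comp_left (h.contDiffAt.of_le (by norm_cast)),
    Function.comp_apply, inner_coordEmbedding, laplacian_eq_sum_pderiv3 h, Finset.mul_sum]

lemma inner_fderiv_coordField {θ : E3 → ℝ} (h : ContDiff ℝ ∞ θ) (a : Fin 3) (v z x : E3) :
    inner ℝ v (fderiv ℝ (coordField a θ) x z) = ∑ j, (v a * z j) * pderiv3 j θ x := by
  have hd : HasFDerivAt θ (fderiv ℝ θ x) x := (h.differentiable (by simp) x).hasFDerivAt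
  have := ((coordEmbedding a).hasFDerivAt.comp x hd).fderiv
  rw [coordField_eq, this, ContinuousLinearMap.comp_apply, inner_coordEmbedding, clm_apply_eq_sum,
    Finset.mul_sum]
  exact Finset.sum_congr rfl fun j _ => by rw [mul_assoc]; rfl

lemma pderiv3_coordField (a b j : Fin 3) (θ : E3 → ℝ) (x : E3) :
    pderiv3 j (fun y => coordField a θ y b) x = if b = a then pderiv3 j θ x else 0 := by
  by_cases hb : b = a
  · simp [coordField_apply, hb]
  · simp [coordField_apply, hb, pderiv3]

lemma divergence3_coordField (a : Fin 3) (θ : E3 → ℝ) :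
    divergence3 (coordField a θ) = pderiv3 a θ := by
  ext x
  simp [divergence3, pderiv3_coordField]

lemma inner_curl3_coordField (a : Fin 3) (θ : E3 → ℝ) (v x : E3) :
    inner ℝ v (curl3 (coordField a θ) x) =
      ∑ b, ∑ j, leviCivita b j a * (v b * pderiv3 j θ x) := by
  have h : inner ℝ v (curl3 (coordField a θ) x) = ∑ b, v b * curl3 (coordField a θ) x b := by
    simp [PiLp.inner_apply, mul_comm]
  have ha : a = 0 ∨ a = 1 ∨ a = 2 := by fin_cases a <;> simp
  rw [h]
  rcases ha with rfl | rfl | rfl <;>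
    simp [curl3, pderiv3_coordField, Fin.sum_univ_three, leviCivita] <;> norm_num

section

variable {κ : ℝ} {f g u w : E3 → E3} {p : E3 → ℝ}

lemma LocL2.locallyIntegrable {F : E3 → ℝ} (hF : LocL2 F) : LocallyIntegrable F := by
  rw [locallyIntegrable_iff]
  intro K hK
  have : IsFiniteMeasure (volume.restrict K) := isFiniteMeasure_restrict.2 hK.measure_ne_top
  exact (hF K hK).integrable (by norm_num)

lemma LocL2.locallyIntegrable_mul {F G : E3 → ℝ} (hF : LocL2 F) (hG : LocL2 G) :
    LocallyIntegrable fun x => F x * G x := by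
  rw [locallyIntegrable_iff]
  intro K hK
  exact (hF K hK).integrable_mul (hG K hK)

lemma locL2_coord {v : E3 → E3} (h : ∀ K : Set E3, IsCompact K → MemLp v 2 (volume.restrict K))
    (a : Fin 3) : LocL2 fun x => v x a := fun K hK =>
  (EuclideanSpace.proj a : E3 →L[ℝ] ℝ).comp_memLp' (h K hK)

lemma locallyIntegrable_coord {v : E3 → E3} (h : LocallyIntegrable v) (a : Fin 3) :
    LocallyIntegrable fun x => v x a := by
  rw [locallyIntegrable_iff] at h ⊢
  intro K hK
  exact (EuclideanSpace.proj a : E3 →L[ℝ] ℝ).integrable_comp (h K hK)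

lemma WeaklyDivFree.sum_deriv_eq_zero {v : E3 → E3} (h : WeaklyDivFree v)
    (hv : ∀ a, LocallyIntegrable fun x => v x a) :
    ∑ a, ofFun (fun x => v x a) (hv a) ∘ₗ deriv a = 0 := by
  refine distr_eq_zero_of_realTest fun θ h1 h2 => ?_
  have h0 := h θ h1 h2
  simp only [inner_gradient] at h0
  have := HasRealIntegral.sum Finset.univ fun (a : Fin 3) _ =>
    HasRealIntegral.ofFun_deriv (hv a) h1 h2 a
  simpa using this.eq_zero h0

/-- The field `θ e_a` isolates the `a`-th equation. `HasRealIntegral` carries the integrability of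
each term, so the single integral splits into pairings. -/
lemma IsWeakMicropolarSolution.system (h : IsWeakMicropolarSolution κ f g u p w)
    (hu : ∀ a, LocallyIntegrable fun x => u x a) (hw : ∀ a, LocallyIntegrable fun x => w x a)
    (hf : ∀ a, LocallyIntegrable fun x => f x a) (hg : ∀ a, LocallyIntegrable fun x => g x a)
    (huu : ∀ a j, LocallyIntegrable fun x => u x a * u x j)
    (hwu : ∀ a j, LocallyIntegrable fun x => w x a * u x j) :
    MicropolarSystem κ (fun a => ofFun _ (hu a)) (fun a => ofFun _ (hw a))
      (fun a => ofFun _ (hf a)) (fun a => ofFun _ (hg a)) (ofFun p h.locallyIntegrable_p)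
      (fun a j => ofFun _ (huu a j)) (fun a j => ofFun _ (hwu a j)) where
  div_u := h.div_u.sum_deriv_eq_zero hu
  div_f := h.div_f.sum_deriv_eq_zero hf
  velocity a := by
    refine distr_eq_zero_of_realTest fun θ h1 h2 => ?_
    have h0 := h.velocity_eq (coordField a θ) (contDiff_coordField h1 a)
      (hasCompactSupport_coordField h2 a)
    simp only [inner_laplacian_coordField h1, inner_fderiv_coordField h1, divergence3_coordField,
      inner_curl3_coordField] at h0
    simp only [coordField_eq, Function.comp_apply, inner_coordEmbedding] at h0
    have key := ((((HasRealIntegral.sum Finset.univ fun (j : Fin 3) _ =>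
        HasRealIntegral.ofFun_deriv_deriv (hu a) h1 h2 j j).add
      (HasRealIntegral.sum Finset.univ fun (j : Fin 3) _ =>
        HasRealIntegral.ofFun_deriv (huu a j) h1 h2 j)).add
      (HasRealIntegral.ofFun_deriv h.locallyIntegrable_p h1 h2 a)).add
      ((HasRealIntegral.sum Finset.univ fun (b : Fin 3) _ =>
        HasRealIntegral.sum Finset.univ fun (j : Fin 3) _ =>
        (HasRealIntegral.ofFun_deriv (hw b) h1 h2 j).const_mul (leviCivita b j a)).const_mul
          (1 / 2))).add (HasRealIntegral.ofFun (hf a) h1 h2)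
    have := key.eq_zero h0
    simpa [testLaplacian] using this
  microrotation a := by
    refine distr_eq_zero_of_realTest fun θ h1 h2 => ?_
    have h0 := h.microrotation_eq (coordField a θ) (contDiff_coordField h1 a)
      (hasCompactSupport_coordField h2 a)
    simp only [inner_laplacian_coordField h1, inner_fderiv_coordField h1, divergence3_coordField,
      inner_curl3_coordField, inner_gradient] at h0
    simp only [coordField_eq, Function.comp_apply, inner_coordEmbedding] at h0
    have key := (((((HasRealIntegral.sum Finset.univ fun (j : Fin 3) _ =>
        HasRealIntegral.ofFun_deriv_deriv (hw a) h1 h2 j j).add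
      (HasRealIntegral.sum Finset.univ fun (b : Fin 3) _ =>
        HasRealIntegral.ofFun_deriv_deriv (hw b) h1 h2 b a)).sub
      ((HasRealIntegral.ofFun (hw a) h1 h2).const_mul κ)).add
      (HasRealIntegral.sum Finset.univ fun (j : Fin 3) _ =>
        HasRealIntegral.ofFun_deriv (hwu a j) h1 h2 j)).add
      ((HasRealIntegral.sum Finset.univ fun (b : Fin 3) _ =>
        HasRealIntegral.sum Finset.univ fun (j : Fin 3) _ =>
        (HasRealIntegral.ofFun_deriv (hu b) h1 h2 j).const_mul (leviCivita b j a)).const_mul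
          (1 / 2))).add (HasRealIntegral.ofFun (hg a) h1 h2)
    have := key.eq_zero h0
    simpa [testLaplacian] using this

end

/-! ### Conclusion -/

lemma exists_contDiff_of_coord {v : E3 → E3}
    (h : ∀ a, ∃ F : E3 → ℝ, (fun x => v x a) =ᵐ[volume] F ∧ ContDiff ℝ ∞ F) :
    ∃ v' : E3 → E3, v =ᵐ[volume] v' ∧ ContDiff ℝ ∞ v' := by
  choose F hF hF' using h
  refine ⟨fun x => WithLp.toLp 2 fun a => F a x, ?_, ?_⟩
  · filter_upwards [ae_all_iff.2 hF] with x hx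
    ext a
    exact hx a
  · rw [contDiff_euclidean]
    exact hF'

theorem theorem2 (κ : ℝ) (hκ : 0 < κ) (f g u : E3 → E3) (p : E3 → ℝ) (w : E3 → E3)
    (hf₁ : VecInHomSobolev (-1) f) (hf₂ : VecInHomSobolev (-2) f)
    (hg₁ : VecInHomSobolev (-1) g) (hg₂ : VecInHomSobolev (-2) g)
    (hreg : (f = 0 ∧ g = 0) ∨ (ContDiff ℝ ∞ f ∧ ContDiff ℝ ∞ g))
    (hsol : IsWeakMicropolarSolution κ f g u p w)
    (hu : VecInHomSobolev 1 u) (hw : VecInSobolev 1 w) (hp : InHomSobolev (1 / 2) p) :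
    ∃ (u' : E3 → E3) (p' : E3 → ℝ) (w' : E3 → E3),
      (u =ᵐ[volume] u' ∧ ContDiff ℝ ∞ u') ∧
      (p =ᵐ[volume] p' ∧ ContDiff ℝ ∞ p') ∧
      (w =ᵐ[volume] w' ∧ ContDiff ℝ ∞ w') := by
  have hsmooth : ContDiff ℝ ∞ f ∧ ContDiff ℝ ∞ g := by
    rcases hreg with ⟨rfl, rfl⟩ | h
    · exact ⟨contDiff_const, contDiff_const⟩
    · exact h
  have hu2 := locL2_coord hsol.memLp_u
  have hw2 := locL2_coord hsol.memLp_w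
  have hui := fun a => (hu2 a).locallyIntegrable
  have hwi := fun a => (hw2 a).locallyIntegrable
  have hfi := locallyIntegrable_coord hsol.locallyIntegrable_f
  have hgi := locallyIntegrable_coord hsol.locallyIntegrable_g
  have huu := fun a j => (hu2 a).locallyIntegrable_mul (hu2 j)
  have hwu := fun a j => (hw2 a).locallyIntegrable_mul (hu2 j)
  have hw1 : ∀ a, InHomSobolev 1 fun x => w x a := fun a => by
    obtain ⟨T, hT, hT'⟩ := hw a
    exact ⟨T, hT, memHomSobolev_one_of_memSobolev hT'⟩
  have key := (hsol.system hui hwi hfi hgi huu hwu).locSobolev_all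
    (fun a => LocSobolev.of_contDiff (hfi a) (contDiff_euclidean.1 hsmooth.1 a))
    (fun a => LocSobolev.of_contDiff (hgi a) (contDiff_euclidean.1 hsmooth.2 a))
    (fun s hs hU a j => LocSobolev.mul (hui a) (hui j) (huu a j) (hu2 a) (hu2 j) hs (hU a) (hU j))
    (fun s hs hU hW a j =>
      LocSobolev.mul (hwi a) (hui j) (hwu a j) (hw2 a) (hu2 j) hs (hW a) (hU j))
    (fun a => LocSobolev.of_inHomSobolev (hui a) zero_le_one (hu a))
    (fun a => LocSobolev.of_inHomSobolev (hwi a) zero_le_one (hw1 a))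
    -- The pressure has local order `1/2`; the induction starts from `1/4 = 1 - 3/4`.
    ((LocSobolev.of_inHomSobolev hsol.locallyIntegrable_p (by norm_num) hp).mono (by norm_num))
  obtain ⟨u', hu'⟩ := exists_contDiff_of_coord fun a =>
    exists_contDiff_of_locSobolev (hui a) fun s => (key s).1 a
  obtain ⟨w', hw'⟩ := exists_contDiff_of_coord fun a =>
    exists_contDiff_of_locSobolev (hwi a) fun s => (key s).2.1 a
  obtain ⟨p', hp'⟩ := exists_contDiff_of_locSobolev hsol.locallyIntegrable_p
    fun s => (key s).2.2
  exact ⟨u', p', w', hu', hp', hw'⟩
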